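/- **Theorem.** Let $(X,\mathcal X,\mu)$ be a standard Lebesgue space, i.e. a standard Borel space with a non-atomic probability measure $\mu$. Let $G=\mathrm{Aut}(X,\mathcal X,\mu)$ be the Polish group of all invertible $\mu$-preserving transformations of $X$, where two transformations that agree $\mu$-almost everywhere are identified, with the group topology in which the sets $N(A,\varepsilon)=\{T\in G:\mu(A\,\triangle\,TA)<\varepsilon\}$ ($A\in\mathcal X$, $\varepsilon>0$) form a subbasis of neighbourhoods of the identity. An action of a topological group $H$ on $(X,\mathcal X,\mu)$, given by a continuous homomorphism $H\to G$, is called *whirly* if for all $A,B\in\mathcal X$ of positive measure every neighbourhood of the identity of $H$ contains some $h$ with $\mu(A\cap hB)>0$. For $T\in G$ let $\Lambda(T)=\overline{\{T^n:n\in\mathbb Z\}}\subseteq G$, acting on $(X,\mathcal X,\mu)$ through the inclusion $\Lambda(T)\hookrightarrow G$. Call $T\in G$ *whirly* if for every neighbourhood $U$ of the identity in $G$ and all $A,B\in\mathcal X$ of positive measure there is $n\in\mathbb Z$ with $T^n\in U$ and $\mu(T^nA\cap B)>0$. Then $T$ is whirly if and only if the action of $\Lambda(T)$ on $(X,\mathcal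 X,\mu)$ is whirly, and the set of all such $T$ is a dense $G_\delta$ subset of $G$. -/

import Mathlib

open MeasureTheory Filter Set
open scoped symmDiff ENNReal Topology

noncomputable section

namespace Whirly

variable {X : Type*} [MeasurableSpace X]

/-- The group of invertible measure preserving transformations of `(X, μ)`
(honest bijections of `X`, measurable and measure preserving in both directions). -/
def mpGroup (μ : Measure X) : Subgroup (Equiv.Perm X) where
  carrier := {f | MeasurePreserving f μ μ ∧ MeasurePreserving f.symm μ μ}
  mul_mem' := fun ha hb => ⟨ha.1.comp hb.1, hb.2.comp ha.2⟩
  one_mem' := ⟨MeasurePreserving.id μ, MeasurePreserving.id μ⟩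
  inv_mem' := fun ha => ⟨ha.2, ha.1⟩

variable {μ : Measure X}

theorem mpGroup.mp (f : mpGroup μ) : MeasurePreserving (f : Equiv.Perm X) μ μ := f.2.1

theorem mpGroup.mp_symm (f : mpGroup μ) : MeasurePreserving (f : Equiv.Perm X).symm μ μ := f.2.2

/-- The normal subgroup of the transformations that are almost everywhere the identity. -/
def nullGroup (μ : Measure X) : Subgroup (mpGroup μ) where
  carrier := {f | ∀ᵐ x ∂μ, (f : Equiv.Perm X) x = x}
  mul_mem' := by
    intro f g hf hg
    filter_upwards [hg, (mpGroup.mp g).quasiMeasurePreserving.ae hf] with x h1 h2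
    change (f : Equiv.Perm X) ((g : Equiv.Perm X) x) = x
    rw [h2, h1]
  one_mem' := by
    change ∀ᵐ x ∂μ, (1 : Equiv.Perm X) x = x
    simp
  inv_mem' := by
    intro f hf
    change ∀ᵐ x ∂μ, (f : Equiv.Perm X).symm x = x
    have hf' : ∀ᵐ x ∂μ, (f : Equiv.Perm X) x = x := hf
    filter_upwards [hf'] with x hx
    rw [Equiv.symm_apply_eq]
    exact hx.symm

instance nullGroup_normal (μ : Measure X) : (nullGroup μ).Normal where
  conj_mem := by
    intro f hf g
    filter_upwards [(mpGroup.mp_symm g).quasiMeasurePreserving.ae hf] with x hx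
    change (g : Equiv.Perm X) ((f : Equiv.Perm X) ((g : Equiv.Perm X).symm x)) = x
    rw [hx, Equiv.apply_symm_apply]

/-- `Aut(X, μ)`: invertible measure preserving transformations modulo almost everywhere
equality. -/
def Aut (μ : Measure X) : Type _ := mpGroup μ ⧸ nullGroup μ

instance Aut.group (μ : Measure X) : Group (Aut μ) :=
  inferInstanceAs (Group (mpGroup μ ⧸ nullGroup μ))

namespace Aut

/-- The class of an invertible measure preserving transformation. -/
def mk (μ : Measure X) : mpGroup μ →* Aut μ := QuotientGroup.mk' (nullGroup μ)

/-- Two transformations define the same automorphism iff they agree almost everywhere. -/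
theorem mk_eq_mk (f g : mpGroup μ) :
    mk μ f = mk μ g ↔ ∀ᵐ x ∂μ, (f : Equiv.Perm X) x = (g : Equiv.Perm X) x := by
  have h : mk μ f = mk μ g ↔ f⁻¹ * g ∈ nullGroup μ := QuotientGroup.eq
  rw [h]
  change (∀ᵐ x ∂μ, (f : Equiv.Perm X).symm ((g : Equiv.Perm X) x) = x) ↔ _
  refine eventually_congr (Eventually.of_forall fun x => ?_)
  rw [Equiv.symm_apply_eq, eq_comm]

/-- A transformation representing the class `T`. -/
def rep (T : Aut μ) : mpGroup μ := Quotient.out T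

theorem mk_rep (T : Aut μ) : mk μ (rep T) = T := Quotient.out_eq T

/-- The set `T A`, well defined up to null sets (see `image_mk`). -/
def image (T : Aut μ) (A : Set X) : Set X := (rep T : Equiv.Perm X) '' A

theorem image_congr_aux {f g : mpGroup μ} (h : mk μ f = mk μ g) (A : Set X) :
    ((f : Equiv.Perm X) '' A : Set X) =ᵐ[μ] ((g : Equiv.Perm X) '' A : Set X) := by
  have h' : mk μ f⁻¹ = mk μ g⁻¹ := by rw [map_inv, map_inv, h]
  rw [mk_eq_mk] at h'
  rw [Filter.eventuallyEq_set]
  filter_upwards [h'] with x hx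
  have hx' : (f : Equiv.Perm X).symm x = (g : Equiv.Perm X).symm x := hx
  rw [Equiv.image_eq_preimage_symm, Equiv.image_eq_preimage_symm, mem_preimage, mem_preimage, hx']

/-- The set `T A` does not depend, modulo null sets, on the representative of `T`. -/
theorem image_mk (f : mpGroup μ) (A : Set X) :
    image (mk μ f) A =ᵐ[μ] ((f : Equiv.Perm X) '' A : Set X) :=
  image_congr_aux (mk_rep _) A

theorem measurableSet_image (T : Aut μ) {A : Set X} (hA : MeasurableSet A) :
    MeasurableSet (image T A) := by
  rw [image, Equiv.image_eq_preimage_symm]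
  exact (mpGroup.mp_symm (rep T)).measurable hA

theorem measure_image (T : Aut μ) {A : Set X} (hA : MeasurableSet A) :
    μ (image T A) = μ A := by
  rw [image, Equiv.image_eq_preimage_symm]
  exact (mpGroup.mp_symm (rep T)).measure_preimage hA.nullMeasurableSet

theorem image_symmDiff (T : Aut μ) (A B : Set X) :
    image T (A ∆ B) = image T A ∆ image T B :=
  Set.image_symmDiff (rep T : Equiv.Perm X).injective A B

theorem image_one (A : Set X) : image (1 : Aut μ) A =ᵐ[μ] A := by
  have h := image_mk (1 : mpGroup μ) A
  rw [map_one] at h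
  simpa using h

theorem image_mul (S T : Aut μ) (A : Set X) :
    image (S * T) A =ᵐ[μ] image S (image T A) := by
  have h := image_mk (rep S * rep T) A
  rw [map_mul, mk_rep, mk_rep] at h
  refine h.trans (Eq.eventuallyEq ?_)
  change _ = (rep S : Equiv.Perm X) '' ((rep T : Equiv.Perm X) '' A)
  rw [← Set.image_comp]
  rfl

/-- The set `N(A, ε)` of all `T` with `μ (A ∆ T A) < ε`. -/
def N (μ : Measure X) (A : Set X) (ε : ℝ≥0∞) : Set (Aut μ) :=
  {T | μ (A ∆ image T A) < ε}

/-- The topology of `Aut(X, μ)`: the sets `N(A, ε)`, for `A` measurable and `ε > 0`, and their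
left translates form a subbasis. -/
instance topology (μ : Measure X) : TopologicalSpace (Aut μ) :=
  TopologicalSpace.generateFrom
    {V | ∃ (T : Aut μ) (A : Set X) (ε : ℝ≥0∞), MeasurableSet A ∧ 0 < ε ∧
      V = {S | T⁻¹ * S ∈ N μ A ε}}

theorem measure_translate (T S : Aut μ) {A : Set X} (hA : MeasurableSet A) :
    μ (A ∆ image (T⁻¹ * S) A) = μ (image T A ∆ image S A) := by
  rw [← measure_image T (hA.symmDiff (measurableSet_image _ hA)), image_symmDiff]
  refine measure_congr ((ae_eq_refl _).symmDiff ?_)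
  have h := (image_mul T (T⁻¹ * S) A).symm
  rwa [mul_inv_cancel_left] at h

/-- Convergence `S i → T` means `μ (T A ∆ S i A) → 0` for every measurable set `A`. -/
theorem tendsto_iff {ι : Type*} {l : Filter ι} {S : ι → Aut μ} {T : Aut μ} :
    Tendsto S l (𝓝 T) ↔ ∀ A : Set X, MeasurableSet A →
      Tendsto (fun i => μ (image T A ∆ image (S i) A)) l (𝓝 0) := by
  constructor
  · intro h A hA
    rw [ENNReal.tendsto_nhds_zero]
    intro ε hε
    have hopen : IsOpen {S : Aut μ | T⁻¹ * S ∈ N μ A ε} :=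
      TopologicalSpace.isOpen_generateFrom_of_mem ⟨T, A, ε, hA, hε, rfl⟩
    have hmem : T ∈ {S : Aut μ | T⁻¹ * S ∈ N μ A ε} := by
      change μ _ < ε
      rw [measure_translate T T hA]
      simpa using hε
    filter_upwards [h (hopen.mem_nhds hmem)] with i hi
    have hi' : μ (A ∆ image (T⁻¹ * S i) A) < ε := hi
    rw [measure_translate T (S i) hA] at hi'
    exact hi'.le
  · intro h
    rw [TopologicalSpace.tendsto_nhds_generateFrom_iff]
    rintro V ⟨T', A, ε, hA, hε, rfl⟩ hT
    have hT' : μ (image T' A ∆ image T A) < ε := by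
      rw [← measure_translate T' T hA]; exact hT
    have hpos : 0 < ε - μ (image T' A ∆ image T A) := tsub_pos_of_lt hT'
    filter_upwards [(h A hA).eventually (gt_mem_nhds hpos)] with i hi
    change μ _ < ε
    rw [measure_translate T' (S i) hA]
    refine (measure_symmDiff_le _ (image T A) _).trans_lt ?_
    rw [add_comm]
    exact lt_tsub_iff_right.mp hi

instance isTopologicalGroup (μ : Measure X) : IsTopologicalGroup (Aut μ) where
  continuous_mul := by
    rw [continuous_iff_continuousAt]
    rintro ⟨S, T⟩
    refine tendsto_iff.2 fun A hA => ?_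
    have h1 : Tendsto (fun p : Aut μ × Aut μ => p.1) (𝓝 (S, T)) (𝓝 S) := continuousAt_fst
    have h2 : Tendsto (fun p : Aut μ × Aut μ => p.2) (𝓝 (S, T)) (𝓝 T) := continuousAt_snd
    have h := (tendsto_iff.1 h1 _ (measurableSet_image T hA)).add (tendsto_iff.1 h2 A hA)
    rw [add_zero] at h
    refine tendsto_of_tendsto_of_tendsto_of_le_of_le tendsto_const_nhds h
      (fun _ => zero_le) fun p => ?_
    calc μ (image (S * T) A ∆ image (p.1 * p.2) A)
        = μ (image S (image T A) ∆ image p.1 (image p.2 A)) :=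
          measure_congr ((image_mul S T A).symmDiff (image_mul p.1 p.2 A))
      _ ≤ μ (image S (image T A) ∆ image p.1 (image T A))
          + μ (image p.1 (image T A) ∆ image p.1 (image p.2 A)) := measure_symmDiff_le _ _ _
      _ = _ := by
          rw [← image_symmDiff p.1, measure_image p.1
            ((measurableSet_image T hA).symmDiff (measurableSet_image p.2 hA))]
  continuous_inv := by
    rw [continuous_iff_continuousAt]
    intro T
    refine tendsto_iff.2 fun A hA => ?_
    have h := tendsto_iff.1 (tendsto_id (x := 𝓝 T)) _ (measurableSet_image T⁻¹ hA)
    refine h.congr fun S => ?_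
    have e1 : image T (image T⁻¹ A) =ᵐ[μ] A := by
      have := (image_mul T T⁻¹ A).symm
      rw [mul_inv_cancel] at this
      exact this.trans (image_one A)
    have e2 : image S (image S⁻¹ A) =ᵐ[μ] A := by
      have := (image_mul S S⁻¹ A).symm
      rw [mul_inv_cancel] at this
      exact this.trans (image_one A)
    calc μ (image T (image T⁻¹ A) ∆ image S (image T⁻¹ A))
        = μ (image S (image S⁻¹ A) ∆ image S (image T⁻¹ A)) :=
          measure_congr ((e1.trans e2.symm).symmDiff (ae_eq_refl _))
      _ = μ (image S⁻¹ A ∆ image T⁻¹ A) := by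
          rw [← image_symmDiff S, measure_image S
            ((measurableSet_image _ hA).symmDiff (measurableSet_image _ hA))]
      _ = μ (image T⁻¹ A ∆ image S⁻¹ A) := by rw [symmDiff_comm]

end Aut

/-- A boolean action of a topological group `G` on `(X, μ)`, i.e. a continuous homomorphism
`π : G → Aut(X, μ)`, is whirly if for all sets `A`, `B` of positive measure every neighbourhood
of the identity of `G` contains some `g` with `μ (A ∩ g B) > 0`. -/
def IsWhirlyAction {G : Type*} [Group G] [TopologicalSpace G] (π : G →ₜ* Aut μ) : Prop :=
  ∀ A B : Set X, MeasurableSet A → MeasurableSet B → 0 < μ A → 0 < μ B →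
    ∀ U ∈ 𝓝 (1 : G), ∃ g ∈ U, 0 < μ (A ∩ (π g).image B)

/-- `Λ(T)`, the closure in `Aut(X, μ)` of the cyclic group generated by `T`. -/
def Lam (T : Aut μ) : Subgroup (Aut μ) := (Subgroup.zpowers T).topologicalClosure

/-- The natural action of `Λ(T)` on `(X, μ)`. -/
def lamAction (T : Aut μ) : Lam T →ₜ* Aut μ where
  toMonoidHom := (Lam T).subtype
  continuous_toFun := continuous_subtype_val

/-- `T` is whirly: for every neighbourhood `U` of the identity of `Aut(X, μ)` and all sets `A`,
`B` of positive measure there is an integer `n` with `T ^ n ∈ U` and `μ (T ^ n A ∩ B) > 0`. -/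
def IsWhirly (T : Aut μ) : Prop :=
  ∀ U ∈ 𝓝 (1 : Aut μ), ∀ A B : Set X, MeasurableSet A → MeasurableSet B → 0 < μ A → 0 < μ B →
    ∃ n : ℤ, T ^ n ∈ U ∧ 0 < μ ((T ^ n).image A ∩ B)

end Whirly

end

set_option linter.unusedSectionVars false

/-! ### Measurable sets moved by automorphisms: continuity, the role of `Λ(T)`, a countable base at
the identity. -/

namespace Whirly

variable {X : Type*} [MeasurableSpace X] {μ : Measure X}

namespace Aut

/-! For fixed `A`, `B` the condition `0 < μ (S A ∩ B)` is open in `S`, so an element of `Λ(T)`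
satisfying it can be replaced by a nearby power of `T`. This gives the equivalence of the two
notions.

For the `G_δ` property the quantifier over all `A`, `B` must become countable, but failure of
whirliness is not stable under perturbing the sets. It is therefore recorded in a robust form
(`obstructed`): a density `h` with values in `[0, 1]`, with mean at most 1/8 on `P` and at least 7/8
on `Q`, that changes by at most 1/2 under all powers of `T` lying in `V`. If the powers in a
symmetric `V` never carry `A` into `B`, let `W` be the union of the images of `A` under them: the
function equal to 0 on `A`, 1/2 on `W \ A` and 1 off `W` is such a density, also for all `P`, `Q`
close to `A`, `B`. Conversely a whirly `T` would carry part of `{h ≤ 1/8}` into `{h ≥ 7/8}`, a jump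
of 3/4. Obstruction is a closed condition because set functions dominated by `μ` form a compact
space (`isClosed_obstructed`). So the whirly `T` form a countable intersection of open sets
(`setOf_isWhirly_eq`).

`Aut μ` is a Baire space, so density reduces to approximating any `T₀` by unobstructed
transformations (`dense_compl_obstructed`). Take `r` cycles of long, pairwise coprime lengths, each
of total mass `1 / r`, times `X ^ ℕ`, and let `f` rotate the cycles. Identify this space with `X` so
that, on finitely many sets, running along a cycle looks like applying powers of `T₀` to a sample
point, with a fresh independent sample after every `L` steps. Then `f` is close to `T₀`. By the
Chinese remainder theorem some power of `f` rotates one cycle by any prescribed amount and fixes the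
others; it is near the identity when `r` is large, so an obstructing density would vary by at most
1/2 along each cycle. By the weak law of large numbers almost every long cycle visits `P` and `Q`
with nearly the right frequencies, so the means over `P` and `Q` could differ by only slightly more
than 1/2, not by 3/4. -/

theorem image_mono (T : Aut μ) {A B : Set X} (h : A ⊆ B) : image T A ⊆ image T B :=
  Set.image_mono h

theorem image_inv_image (T : Aut μ) (A : Set X) : image T⁻¹ (image T A) =ᵐ[μ] A := by
  have h := (image_mul T⁻¹ T A).symm
  rw [inv_mul_cancel] at h
  exact h.trans (image_one A)

theorem mk_rep_zpow (T : Aut μ) (n : ℤ) : mk μ (rep T ^ n) = T ^ n := by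
  rw [map_zpow, mk_rep]

end Aut

theorem measureReal_symmDiff_congr {A A' B B' : Set X} (hA : A =ᵐ[μ] A') (hB : B =ᵐ[μ] B') :
    μ.real (A ∆ B) = μ.real (A' ∆ B') :=
  measureReal_congr (hA.symmDiff hB)

theorem measureReal_symmDiff_congr_left {A A' : Set X} (hA : A =ᵐ[μ] A') (B : Set X) :
    μ.real (A ∆ B) = μ.real (A' ∆ B) :=
  measureReal_symmDiff_congr hA (ae_eq_refl B)

theorem measureReal_symmDiff_congr_right (A : Set X) {B B' : Set X} (hB : B =ᵐ[μ] B') :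
    μ.real (A ∆ B) = μ.real (A ∆ B') :=
  measureReal_symmDiff_congr (ae_eq_refl A) hB

theorem measureReal_pos_iff_measure_pos [IsFiniteMeasure μ] {A : Set X} :
    0 < μ.real A ↔ 0 < μ A := by
  rw [Measure.real, ENNReal.toReal_pos_iff]
  exact and_iff_left (measure_lt_top μ A)

namespace Aut

theorem measureReal_image (T : Aut μ) {A : Set X} (hA : MeasurableSet A) :
    μ.real (image T A) = μ.real A := by
  rw [Measure.real, measure_image T hA, Measure.real]

theorem measureReal_image_symmDiff (T : Aut μ) {A B : Set X} (hA : MeasurableSet A)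
    (hB : MeasurableSet B) : μ.real (image T A ∆ image T B) = μ.real (A ∆ B) := by
  rw [← image_symmDiff, measureReal_image T (hA.symmDiff hB)]

variable [IsProbabilityMeasure μ]

theorem tendsto_iff_measureReal {ι : Type*} {l : Filter ι} {S : ι → Aut μ} {T : Aut μ} :
    Tendsto S l (𝓝 T) ↔ ∀ A : Set X, MeasurableSet A →
      Tendsto (fun i => μ.real (image T A ∆ image (S i) A)) l (𝓝 0) := by
  rw [tendsto_iff]
  refine forall₂_congr fun A _ => ?_
  rw [← ENNReal.tendsto_toReal_iff (fun _ => measure_ne_top _ _) (by simp)]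
  simp [Measure.real]

theorem continuous_measureReal_symmDiff_image {A : Set X} (hA : MeasurableSet A)
    (B : Set X) : Continuous fun T : Aut μ => μ.real (B ∆ image T A) := by
  rw [continuous_iff_continuousAt]
  intro T
  rw [ContinuousAt, tendsto_iff_norm_sub_tendsto_zero]
  refine squeeze_zero (fun _ => norm_nonneg _) (fun S => ?_)
    (tendsto_iff_measureReal.1 (tendsto_id (x := 𝓝 T)) A hA)
  rw [Real.norm_eq_abs, abs_sub_le_iff, symmDiff_comm (image T A)]
  have h1 := measureReal_symmDiff_le (μ := μ) (s := B) (t := (image T A)) (image S A)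
  have h2 := measureReal_symmDiff_le (μ := μ) (s := B) (t := (image S A)) (image T A)
  rw [symmDiff_comm (image T A)] at h1
  simp only [id]
  constructor <;> linarith

/-- As `T A` has the measure of `A`, the measure of the intersection is an affine function of that
of the symmetric difference. -/
theorem continuous_measureReal_image_inter {A : Set X} (hA : MeasurableSet A) {B : Set X}
    (hB : MeasurableSet B) : Continuous fun T : Aut μ => μ.real (image T A ∩ B) := by
  have h : ∀ T : Aut μ, μ.real (image T A ∩ B) =
      (μ.real A + μ.real B - μ.real (B ∆ image T A)) / 2 := by
    intro T
    have hm := measurableSet_image T hA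
    have h1 := measureReal_inter_add_sdiff (μ := μ) (s := image T A) hB
    have h2 := measureReal_inter_add_sdiff (μ := μ) (s := B) hm
    have h3 : μ.real (B ∆ image T A) = μ.real (B \ image T A) + μ.real (image T A \ B) :=
      measureReal_union (disjoint_sdiff_sdiff) (hm.diff hB)
    rw [measureReal_image T hA] at h1
    rw [inter_comm] at h2
    linarith
  simp only [h]
  exact (continuous_const.sub (continuous_measureReal_symmDiff_image hA B)).div_const 2

theorem isOpen_measure_image_inter_pos {A : Set X} (hA : MeasurableSet A) {B : Set X}
    (hB : MeasurableSet B) : IsOpen {T : Aut μ | 0 < μ (image T A ∩ B)} := by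
  simp only [← measureReal_pos_iff_measure_pos]
  exact isOpen_lt continuous_const (continuous_measureReal_image_inter hA hB)

end Aut

/-- A transformation is whirly iff the natural action of `Λ(T)` is. -/
theorem isWhirly_iff_isWhirlyAction [IsProbabilityMeasure μ] (T : Aut μ) :
    IsWhirly T ↔ IsWhirlyAction (lamAction T) := by
  constructor
  · intro h A B hA hB hA0 hB0 U hU
    rw [nhds_subtype_eq_comap, mem_comap] at hU
    obtain ⟨W, hW, hWU⟩ := hU
    -- The sets trade places: one definition moves the first set, the other moves the second.
    obtain ⟨n, hn, hpos⟩ := h W hW B A hB hA hB0 hA0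
    refine ⟨⟨T ^ n, subset_closure ⟨n, rfl⟩⟩, hWU hn, ?_⟩
    rw [inter_comm]
    exact hpos
  · intro h U hU A B hA hB hA0 hB0
    have hU' : ((↑) : Lam T → Aut μ) ⁻¹' interior U ∈ 𝓝 (1 : Lam T) :=
      continuous_subtype_val.continuousAt.preimage_mem_nhds
        (by simpa using interior_mem_nhds.2 hU)
    obtain ⟨g, hgU, hg⟩ := h B A hB hA hB0 hA0 _ hU'
    have hg2 : (g : Aut μ) ∈ closure ((Subgroup.zpowers T : Subgroup (Aut μ)) : Set (Aut μ)) := g.2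
    -- The element `g` is only a limit of powers of `T`; both properties required of it are open, so
    -- some power shares them.
    have hopen := isOpen_interior.inter (Aut.isOpen_measure_image_inter_pos (μ := μ) hA hB)
      (s := interior U)
    rw [inter_comm] at hg
    obtain ⟨S, ⟨hSU, hS⟩, n, rfl⟩ := mem_closure_iff.1 hg2 _ hopen ⟨hgU, hg⟩
    exact ⟨n, interior_subset hSU, hS⟩

/-- A sequence of measurable sets that is dense in the measure algebra and separates points. -/
structure IsDenseSeparating (μ : Measure X) (A : ℕ → Set X) : Prop where
  measurableSet : ∀ i, MeasurableSet (A i)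
  dense : ∀ B, MeasurableSet B → ∀ ε : ℝ, 0 < ε → ∃ i, μ.real (B ∆ A i) < ε
  separates : ∀ x y, (∀ i, x ∈ A i ↔ y ∈ A i) → x = y

theorem exists_isDenseSeparating [StandardBorelSpace X] (μ : Measure X) [IsProbabilityMeasure μ] :
    ∃ A, IsDenseSeparating μ A := by
  obtain ⟨𝒜, hc, hd⟩ := exists_countable_measureDense (μ := μ)
  obtain ⟨D, hD⟩ := hc.exists_eq_range hd.nonempty
  have hDm : ∀ i, MeasurableSet (D i) := fun i => hd.measurable _ (hD ▸ mem_range_self i)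
  let G := MeasurableSpace.natGeneratingSequence X
  -- Even indices run through a dense family, odd ones through a generating sequence: density in the
  -- measure algebra alone does not separate points.
  refine ⟨fun n => if Even n then D (n / 2) else G (n / 2), ⟨fun i => ?_, fun B hB ε hε => ?_,
    fun x y h => ?_⟩⟩
  · split_ifs
    · exact hDm _
    · exact MeasurableSpace.measurableSet_natGeneratingSequence _
  · obtain ⟨t, ht, hlt⟩ := hd.approx B hB (measure_ne_top _ _) ε hε
    rw [hD] at ht
    obtain ⟨i, rfl⟩ := ht
    refine ⟨2 * i, ?_⟩
    have : 2 * i / 2 = i := by omega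
    simp only [even_two, Even.mul_right, if_true, this]
    exact (ENNReal.lt_ofReal_iff_toReal_lt (measure_ne_top _ _)).1 hlt
  · apply MeasurableSpace.injective_mapNatBool
    funext i
    have := h (2 * i + 1)
    have h2 : (2 * i + 1) / 2 = i := by omega
    have h3 : ¬ Even (2 * i + 1) := by simp
    simp only [h3, if_false, h2] at this
    simpa [MeasurableSpace.mapNatBool, G] using this

namespace Aut

variable [IsProbabilityMeasure μ] {A : ℕ → Set X}

theorem tendsto_of_isDenseSeparating (hA : IsDenseSeparating μ A) {ι : Type*} {l : Filter ι}
    {S : ι → Aut μ} {T : Aut μ}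
    (h : ∀ i, Tendsto (fun j => μ.real (image T (A i) ∆ image (S j) (A i))) l (𝓝 0)) :
    Tendsto S l (𝓝 T) := by
  rw [tendsto_iff_measureReal]
  intro E hE
  rw [Metric.tendsto_nhds]
  intro ε hε
  obtain ⟨i, hi⟩ := hA.dense E hE (ε / 3) (by positivity)
  filter_upwards [(Metric.tendsto_nhds.1 (h i)) (ε / 3) (by positivity)] with j hj
  rw [Real.dist_0_eq_abs, abs_of_nonneg measureReal_nonneg] at hj ⊢
  have h1 := measureReal_symmDiff_le (μ := μ) (s := (image T E)) (t := (image T (A i))) (image (S j) E)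
  have h2 := measureReal_symmDiff_le (μ := μ) (s := image T (A i))
    (t := image (S j) (A i)) (image (S j) E)
  rw [measureReal_image_symmDiff T hE (hA.measurableSet i)] at h1
  rw [measureReal_image_symmDiff (S j) (hA.measurableSet i) hE, symmDiff_comm (A i)] at h2
  linarith

/-- A countable basis of neighbourhoods of the identity. -/
def basicNhd (μ : Measure X) (A : ℕ → Set X) (k : ℕ) : Set (Aut μ) :=
  {T | ∀ i < k, μ.real (A i ∆ image T (A i)) < 1 / ((k : ℝ) + 1)}

theorem isOpen_basicNhd (hA : IsDenseSeparating μ A) (k : ℕ) : IsOpen (basicNhd μ A k) := by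
  have : basicNhd μ A k = ⋂ i ∈ Finset.range k,
      {T | μ.real (A i ∆ image T (A i)) < 1 / ((k : ℝ) + 1)} := by
    ext T
    simp [basicNhd]
  rw [this]
  exact isOpen_biInter_finset fun i _ => isOpen_lt
    (continuous_measureReal_symmDiff_image (hA.measurableSet i) _)
    continuous_const

theorem one_mem_basicNhd (A : ℕ → Set X) (k : ℕ) : 1 ∈ basicNhd μ A k := by
  intro i _
  rw [measureReal_symmDiff_congr_right _ (image_one (A i)), symmDiff_self, bot_eq_empty,
    measureReal_empty]
  positivity

theorem basicNhd_mem_nhds (hA : IsDenseSeparating μ A) (k : ℕ) :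
    basicNhd μ A k ∈ 𝓝 (1 : Aut μ) :=
  (isOpen_basicNhd hA k).mem_nhds (one_mem_basicNhd A k)

theorem inv_mem_basicNhd (hA : IsDenseSeparating μ A) {k : ℕ} {T : Aut μ}
    (h : T ∈ basicNhd μ A k) : T⁻¹ ∈ basicNhd μ A k := by
  intro i hi
  have h1 := h i hi
  have hm := hA.measurableSet i
  rw [← measureReal_image_symmDiff T⁻¹ hm (measurableSet_image T hm)] at h1
  rw [symmDiff_comm]
  rwa [measureReal_symmDiff_congr_right _ (image_inv_image T (A i))] at h1

/-- Otherwise pick a point of each `basicNhd μ A k` outside `U`. As `k` controls both the number of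
sets and the tolerance, these points tend to the identity. -/
theorem exists_basicNhd_subset (hA : IsDenseSeparating μ A) {U : Set (Aut μ)}
    (hU : U ∈ 𝓝 (1 : Aut μ)) : ∃ k, basicNhd μ A k ⊆ U := by
  by_contra! hcon
  simp only [not_subset] at hcon
  choose S hS hSU using hcon
  have hlim : Tendsto S atTop (𝓝 1) := by
    refine tendsto_of_isDenseSeparating hA fun i => ?_
    refine squeeze_zero' (Eventually.of_forall fun _ => measureReal_nonneg) ?_
      tendsto_one_div_add_atTop_nhds_zero_nat
    filter_upwards [eventually_gt_atTop i] with k hk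
    rw [measureReal_symmDiff_congr_left (image_one (A i)) _]
    exact (hS k i hk).le
  obtain ⟨k, hk⟩ := (hlim.eventually hU).exists
  exact hSU k hk

/-- Whatever the set, it differs from its image only at points moved by `f`. This is how powers of
the constructed transformation are seen to be near the identity. -/
theorem mk_mem_basicNhd (f : mpGroup μ) {k : ℕ}
    (hf : μ.real {x | (f : Equiv.Perm X) x ≠ x} < 1 / ((k : ℝ) + 1)) :
    mk μ f ∈ basicNhd μ A k := by
  intro i _
  rw [measureReal_symmDiff_congr_right _ (image_mk f (A i))]
  refine lt_of_le_of_lt ?_ hf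
  have hsub : A i ∆ ((f : Equiv.Perm X) '' A i) ⊆
      (f : Equiv.Perm X).symm ⁻¹' {x | (f : Equiv.Perm X) x ≠ x} := by
    intro x hx
    rw [mem_preimage, mem_ofPred_eq, Equiv.apply_symm_apply]
    intro heq
    rw [Equiv.image_eq_preimage_symm, mem_symmDiff, mem_preimage, ← heq] at hx
    tauto
  have hsub' : A i ∆ ((f : Equiv.Perm X) '' A i) ⊆ {x | (f : Equiv.Perm X) x ≠ x} := by
    refine hsub.trans fun x hx h => hx ?_
    rw [Equiv.apply_symm_apply]
    exact ((Equiv.symm_apply_eq _).2 h.symm).symm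
  exact measureReal_mono hsub' (measure_ne_top _ _)

end Aut

end Whirly

/-! ### Dominated contents, their densities, and closedness of obstruction. -/

namespace Whirly

variable {X : Type*} [MeasurableSpace X] {μ : Measure X}

/-- A finitely additive set function between `0` and `μ`. -/
structure IsDominatedContent (μ : Measure X) (φ : Set X → ℝ) : Prop where
  nonneg : ∀ E, MeasurableSet E → 0 ≤ φ E
  le : ∀ E, MeasurableSet E → φ E ≤ μ.real E
  union : ∀ E F, MeasurableSet E → MeasurableSet F → Disjoint E F → φ (E ∪ F) = φ E + φ F

namespace IsDominatedContent

variable [IsProbabilityMeasure μ] {φ : Set X → ℝ}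

theorem mono (hφ : IsDominatedContent μ φ) {E F : Set X} (hE : MeasurableSet E)
    (hF : MeasurableSet F) (h : E ⊆ F) : φ E ≤ φ F := by
  have := hφ.union E (F \ E) hE (hF.diff hE) disjoint_sdiff_right
  rw [union_sdiff_cancel h] at this
  have := hφ.nonneg _ (hF.diff hE)
  linarith

theorem sub_le (hφ : IsDominatedContent μ φ) {E F : Set X} (hE : MeasurableSet E)
    (hF : MeasurableSet F) : φ E - φ F ≤ μ.real (E ∆ F) := by
  have h1 := hφ.union (E ∩ F) (E \ F) (hE.inter hF) (hE.diff hF)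
    (disjoint_sdiff_right.mono_left inter_subset_right)
  rw [inter_union_sdiff] at h1
  have h2 := hφ.mono (hE.inter hF) hF inter_subset_right
  have h3 := hφ.le _ (hE.diff hF)
  have h4 : μ.real (E \ F) ≤ μ.real (E ∆ F) :=
    measureReal_mono subset_union_left (measure_ne_top _ _)
  linarith

theorem abs_sub_le (hφ : IsDominatedContent μ φ) {E F : Set X} (hE : MeasurableSet E)
    (hF : MeasurableSet F) : |φ E - φ F| ≤ μ.real (E ∆ F) := by
  rw [abs_sub_le_iff]
  exact ⟨hφ.sub_le hE hF, symmDiff_comm E F ▸ hφ.sub_le hF hE⟩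

/-- A finitely additive set function between `0` and `μ` has a density with values in `[0, 1]`. -/
theorem exists_density (hφ : IsDominatedContent μ φ) :
    ∃ h : X → ℝ, Measurable h ∧ (∀ᵐ x ∂μ, 0 ≤ h x) ∧ (∀ᵐ x ∂μ, h x ≤ 1) ∧ Integrable h μ ∧
      ∀ E, MeasurableSet E → φ E = ∫ x in E, h x ∂μ := by
  classical
  -- A vector measure must vanish on nonmeasurable sets, hence the default 0. Domination by `μ`
  -- upgrades finite to countable additivity, and Radon–Nikodym applies.
  let m : Set X → ℝ := fun E => if MeasurableSet E then φ E else 0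
  have hm : ∀ E, MeasurableSet E → m E = φ E := fun E hE => if_pos hE
  let v : SignedMeasure X := VectorMeasure.of_additive_of_le_measure (μ := μ) m
    (by
      intro E
      by_cases hE : MeasurableSet E
      · rw [hm E hE, Real.enorm_eq_ofReal (hφ.nonneg E hE)]
        refine (ENNReal.ofReal_le_ofReal (hφ.le E hE)).trans ?_
        rw [Measure.real, ENNReal.ofReal_toReal (measure_ne_top _ _)]
      · simp [m, hE])
    (by
      intro E F hE hF hd
      rw [hm _ hE, hm _ hF, hm _ (hE.union hF), hφ.union E F hE hF hd])
    (fun E hE => if_neg hE)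
  have hv : ∀ E, MeasurableSet E → v E = φ E := fun E hE => hm E hE
  have hac : v ≪ᵥ μ.toENNRealVectorMeasure := by
    refine VectorMeasure.AbsolutelyContinuous.mk fun E hE h0 => ?_
    rw [Measure.toENNRealVectorMeasure_apply_measurable hE] at h0
    rw [hv E hE]
    have h1 := hφ.le E hE
    rw [Measure.real, h0] at h1
    exact le_antisymm (by simpa using h1) (hφ.nonneg E hE)
  let h := v.rnDeriv μ
  have hint : Integrable h μ := SignedMeasure.integrable_rnDeriv v μ
  have hE : ∀ E, MeasurableSet E → φ E = ∫ x in E, h x ∂μ := by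
    intro E hE
    rw [← hv E hE, ← SignedMeasure.withDensityᵥ_rnDeriv_eq v μ hac, withDensityᵥ_apply hint hE]
  refine ⟨h, SignedMeasure.measurable_rnDeriv v μ, ?_, ?_, hint, hE⟩
  · refine ae_le_of_forall_setIntegral_le (integrable_const 0) hint fun E hEm _ => ?_
    rw [← hE E hEm]
    simpa using hφ.nonneg E hEm
  · refine ae_le_of_forall_setIntegral_le hint (integrable_const 1) fun E hEm _ => ?_
    rw [← hE E hEm]
    simpa using hφ.le E hEm

end IsDominatedContent

/-- The transformations `T` for which some `[0, 1]`-valued density has a small mean over `P`, a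
large mean over `Q`, and changes by at most `1 / 2` under the powers of `T` in `V`. -/
def obstructed (μ : Measure X) (V : Set (Aut μ)) (P Q : Set X) : Set (Aut μ) :=
  {T | ∃ φ : Set X → ℝ, IsDominatedContent μ φ ∧ φ P ≤ 1 / 8 * μ.real P ∧ 7 / 8 * μ.real Q ≤ φ Q ∧
    ∀ n : ℤ, T ^ n ∈ V → ∀ E, MeasurableSet E → |φ ((T ^ n).image E) - φ E| ≤ 1 / 2 * μ.real E}

variable [IsProbabilityMeasure μ]

/-- By compactness of `[0, μ E]`, contents witnessing obstruction converge along an ultrafilter, set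
by set. Finite additivity and domination pass to such limits directly, which is why obstruction is
phrased with contents and not with densities. -/
theorem isClosed_obstructed {V : Set (Aut μ)} (hV : IsOpen V) {P Q : Set X}
    (hP : MeasurableSet P) (hQ : MeasurableSet Q) : IsClosed (obstructed μ V P Q) := by
  rw [isClosed_iff_ultrafilter]
  intro T 𝓤 hT h𝓤
  have hex : ∀ S : Aut μ, ∃ φ : Set X → ℝ, S ∈ obstructed μ V P Q →
      (IsDominatedContent μ φ ∧ φ P ≤ 1 / 8 * μ.real P ∧ 7 / 8 * μ.real Q ≤ φ Q ∧
      ∀ n : ℤ, S ^ n ∈ V → ∀ E, MeasurableSet E → |φ ((S ^ n).image E) - φ E| ≤ 1 / 2 * μ.real E) :=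
    fun S => by
      by_cases h : S ∈ obstructed μ V P Q
      · exact ⟨_, fun _ => h.choose_spec⟩
      · exact ⟨0, fun h' => absurd h' h⟩
  choose Φ hΦ using hex
  have hev : ∀ᶠ S in (𝓤 : Filter (Aut μ)), S ∈ obstructed μ V P Q := h𝓤
  have hlim : ∀ E, MeasurableSet E → ∃ a, Tendsto (fun S => Φ S E) 𝓤 (𝓝 a) := by
    intro E hE
    have hmem : Icc (0 : ℝ) (μ.real E) ∈ 𝓤.map (fun S => Φ S E) := by
      change ∀ᶠ S in (𝓤 : Filter (Aut μ)), Φ S E ∈ Icc (0 : ℝ) (μ.real E)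
      filter_upwards [hev] with S hS
      exact ⟨(hΦ S hS).1.nonneg E hE, (hΦ S hS).1.le E hE⟩
    obtain ⟨a, _, ha⟩ := isCompact_Icc.ultrafilter_le_nhds' _ hmem
    exact ⟨a, ha⟩
  have hlim' : ∀ E, ∃ a, MeasurableSet E → Tendsto (fun S => Φ S E) 𝓤 (𝓝 a) := fun E => by
    by_cases hE : MeasurableSet E
    · exact (hlim E hE).imp fun a ha _ => ha
    · exact ⟨0, fun h => absurd h hE⟩
  choose φ hφ using hlim'
  refine ⟨φ, ⟨fun E hE => ?_, fun E hE => ?_, fun E F hE hF hd => ?_⟩, ?_, ?_, ?_⟩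
  · refine ge_of_tendsto (hφ E hE) ?_
    filter_upwards [hev] with S hS using (hΦ S hS).1.nonneg E hE
  · refine le_of_tendsto (hφ E hE) ?_
    filter_upwards [hev] with S hS using (hΦ S hS).1.le E hE
  · refine tendsto_nhds_unique (hφ _ (hE.union hF)) (((hφ E hE).add (hφ F hF)).congr' ?_)
    filter_upwards [hev] with S hS using ((hΦ S hS).1.union E F hE hF hd).symm
  · refine le_of_tendsto (hφ P hP) ?_
    filter_upwards [hev] with S hS using (hΦ S hS).2.1
  · refine ge_of_tendsto (hφ Q hQ) ?_
    filter_upwards [hev] with S hS using (hΦ S hS).2.2.1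
  · intro n hn E hE
    have hpow : Tendsto (fun S : Aut μ => S ^ n) 𝓤 (𝓝 (T ^ n)) :=
      ((continuous_zpow n).tendsto T).mono_left hT
    have hd := Aut.tendsto_iff_measureReal.1 hpow E hE
    have hTE := Aut.measurableSet_image (T ^ n) hE
    have h1 : Tendsto (fun S => |Φ S ((T ^ n).image E) - Φ S E|) 𝓤
        (𝓝 |φ ((T ^ n).image E) - φ E|) := ((hφ _ hTE).sub (hφ E hE)).abs
    have h2 : Tendsto (fun S : Aut μ => 1 / 2 * μ.real E +
        μ.real ((T ^ n).image E ∆ (S ^ n).image E)) 𝓤 (𝓝 (1 / 2 * μ.real E)) := by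
      simpa using hd.const_add (1 / 2 * μ.real E)
    refine le_of_tendsto_of_tendsto h1 h2 ?_
    -- Since `V` is open, `S ^ n` eventually lies in it. Trading `T ^ n E` for `S ^ n E` costs at
    -- most the measure of their symmetric difference, which tends to 0.
    filter_upwards [hev, hpow.eventually (hV.mem_nhds hn)] with S hS hSn
    have h3 := (hΦ S hS).2.2.2 n hSn E hE
    have h4 := (hΦ S hS).1.abs_sub_le hTE (Aut.measurableSet_image (S ^ n) hE)
    have := abs_sub_le (Φ S ((T ^ n).image E)) (Φ S ((S ^ n).image E)) (Φ S E)
    linarith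

theorem setIntegral_image_mk (f : mpGroup μ) (h : X → ℝ) {E : Set X} :
    ∫ x in (Aut.mk μ f).image E, h x ∂μ = ∫ x in E, h ((f : Equiv.Perm X) x) ∂μ := by
  rw [setIntegral_congr_set (Aut.image_mk f E)]
  let e : X ≃ᵐ X := ⟨f, (mpGroup.mp f).measurable, (mpGroup.mp_symm f).measurable⟩
  have := (mpGroup.mp f).setIntegral_image_emb e.measurableEmbedding h E
  exact this

/-- An obstructed transformation comes with a density that changes by at most `1 / 2` under the
powers of `T` in `V`. -/
theorem exists_density_of_mem_obstructed {V : Set (Aut μ)} {P Q : Set X}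
    (hP : MeasurableSet P) (hQ : MeasurableSet Q) {f : mpGroup μ}
    (hf : Aut.mk μ f ∈ obstructed μ V P Q) :
    ∃ h : X → ℝ, Measurable h ∧ (∀ᵐ x ∂μ, 0 ≤ h x) ∧ (∀ᵐ x ∂μ, h x ≤ 1) ∧ Integrable h μ ∧
      ∫ x in P, h x ∂μ ≤ 1 / 8 * μ.real P ∧ 7 / 8 * μ.real Q ≤ ∫ x in Q, h x ∂μ ∧
      ∀ n : ℤ, Aut.mk μ (f ^ n) ∈ V →
        ∀ᵐ x ∂μ, h (((f ^ n : mpGroup μ) : Equiv.Perm X) x) ≤ h x + 1 / 2 := by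
  obtain ⟨φ, hφ, hφP, hφQ, hφn⟩ := hf
  obtain ⟨h, hm, h0, h1, hint, hE⟩ := hφ.exists_density
  refine ⟨h, hm, h0, h1, hint, hE P hP ▸ hφP, hE Q hQ ▸ hφQ, fun n hn => ?_⟩
  have hcomp := ((mpGroup.mp (f ^ n)).integrable_comp hint.aestronglyMeasurable).2 hint
  refine ae_le_of_forall_setIntegral_le hcomp (hint.add (integrable_const _)) fun E hEm _ => ?_
  have h2 := hφn n (by rwa [← map_zpow]) E hEm
  rw [← map_zpow, hE _ (Aut.measurableSet_image _ hEm), hE E hEm, setIntegral_image_mk] at h2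
  have h3 : ∫ x in E, (h x + 1 / 2) ∂μ = ∫ x in E, h x ∂μ + 1 / 2 * μ.real E := by
    rw [integral_add hint.integrableOn (integrable_const _)]
    simp [mul_comm]
  have h4 := (abs_le.1 h2).2
  change ∫ x in E, h _ ∂μ ≤ ∫ x in E, (h x + 1 / 2) ∂μ
  rw [h3]
  linarith

end Whirly

/-! ### Whirly means unobstructed. -/

namespace Whirly

variable {X : Type*} [MeasurableSpace X] {μ : Measure X} [IsProbabilityMeasure μ]

theorem measureReal_image_diff (T : Aut μ) {E F : Set X} (hE : MeasurableSet E)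
    (hF : MeasurableSet F) : μ.real (T.image E \ F) = μ.real (E \ T⁻¹.image F) := by
  rw [← Aut.measureReal_image T⁻¹ ((Aut.measurableSet_image T hE).diff hF)]
  refine measureReal_congr ?_
  rw [Aut.image, Set.image_sdiff (Equiv.injective _)]
  exact (Aut.image_inv_image T E).diff (ae_eq_refl _)

theorem measureReal_diff_mono_ae {E A B : Set X} (h : A ≤ᵐ[μ] B) :
    μ.real (E \ B) ≤ μ.real (E \ A) :=
  ENNReal.toReal_mono (measure_ne_top _ _)
    (measure_mono_ae (by
    filter_upwards [h] with x hx hx' using ⟨hx'.1, fun hA => hx'.2 (hx hA)⟩))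

/-- The density is half the sum of the indicators of the two complements; for `A ⊆ W` it is 0 on
`A`, 1/2 on `W \ A` and 1 off `W`. -/
theorem isDominatedContent_half {A W : Set X} (hA : MeasurableSet A) (hW : MeasurableSet W) :
    IsDominatedContent μ fun E => (μ.real (E \ A) + μ.real (E \ W)) / 2 where
  nonneg E _ := by positivity
  le E _ := by
    have h1 : μ.real (E \ A) ≤ μ.real E := measureReal_mono sdiff_subset (measure_ne_top _ _)
    have h2 : μ.real (E \ W) ≤ μ.real E := measureReal_mono sdiff_subset (measure_ne_top _ _)
    linarith
  union E F _ hF hd := by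
    rw [union_sdiff_distrib, union_sdiff_distrib,
      measureReal_union (hd.mono sdiff_subset sdiff_subset) (hF.diff hA),
      measureReal_union (hd.mono sdiff_subset sdiff_subset) (hF.diff hW)]
    ring

/-- If the powers of `T` in a symmetric neighbourhood do not move `A` to `B`, then `T` is
obstructed at the approximations of `A` and `B`. -/
theorem mem_obstructed_of_image_inter_null {T : Aut μ} {V : Set (Aut μ)} (hV1 : 1 ∈ V)
    (hVinv : ∀ S ∈ V, S⁻¹ ∈ V) {A B : Set X} (hA : MeasurableSet A) (hB : MeasurableSet B)
    (hAB : ∀ n : ℤ, T ^ n ∈ V → μ ((T ^ n).image A ∩ B) = 0) {P Q : Set X}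
    (hQ : MeasurableSet Q) (hAP : μ.real (A ∆ P) ≤ 1 / 8 * μ.real P)
    (hBQ : μ.real (B ∆ Q) ≤ 1 / 8 * μ.real Q) : T ∈ obstructed μ V P Q := by
  let W : Set X := ⋃ n : {n : ℤ // T ^ n ∈ V}, (T ^ n.1).image A
  have hW : MeasurableSet W := MeasurableSet.iUnion fun n => Aut.measurableSet_image _ hA
  have hsub : ∀ n : ℤ, T ^ n ∈ V → (T ^ n).image A ⊆ W := fun n hn =>
    subset_iUnion (fun n : {n : ℤ // T ^ n ∈ V} => (T ^ n.1).image A) ⟨n, hn⟩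
  have hAW : A ≤ᵐ[μ] W := by
    have h1 := hsub 0 (by simpa using hV1)
    rw [zpow_zero] at h1
    exact (Aut.image_one A).symm.le.trans (LE.le.eventuallyLE h1)
  have hWB : μ (W ∩ B) = 0 := by
    rw [iUnion_inter]
    exact measure_iUnion_null fun n => hAB n.1 n.2
  have hφ := isDominatedContent_half (μ := μ) hA hW
  refine ⟨_, hφ, ?_, ?_, fun n hn E hE => ?_⟩
  · have h1 := measureReal_diff_mono_ae (E := P) hAW
    have h2 : μ.real (P \ A) ≤ μ.real (A ∆ P) :=
      measureReal_mono subset_union_right (measure_ne_top _ _)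
    linarith
  · have h1 : (μ.real (B \ A) + μ.real (B \ W)) / 2 = μ.real B := by
      have h3 : μ.real (B \ W) = μ.real B := by
        refine measureReal_congr ?_
        refine sdiff_ae_eq_self.2 ?_
        rwa [inter_comm]
      have h4 := measureReal_diff_mono_ae (E := B) hAW
      have h5 : μ.real (B \ A) ≤ μ.real B := measureReal_mono sdiff_subset (measure_ne_top _ _)
      linarith
    have h2 := hφ.mono (hQ.inter hB) hQ inter_subset_left
    have h6 := hφ.mono (hB.diff (hQ.inter hB)) hB sdiff_subset
    have h7 := hφ.union _ _ (hQ.inter hB) (hB.diff (hQ.inter hB)) disjoint_sdiff_right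
    rw [union_sdiff_cancel inter_subset_right] at h7
    have h8 := hφ.le _ (hB.diff (hQ.inter hB))
    have h9 := measureReal_inter_add_sdiff (μ := μ) (s := B) (hQ.inter hB)
    have h10 : B ∩ (Q ∩ B) = Q ∩ B := by
      ext x
      simp only [mem_inter_iff]
      tauto
    rw [h10] at h9
    have h11 := measureReal_inter_add_sdiff (μ := μ) (s := Q) hB
    have h12 : μ.real (Q \ B) ≤ μ.real (B ∆ Q) :=
      measureReal_mono subset_union_right (measure_ne_top _ _)
    linarith
  -- `T ^ n` maps `A` into `W`, and since `T ^ (-n)` also lies in `V`, no point off `W` is mapped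
  -- into `A`. So the values 0 and 1 are never exchanged, and any other change is at most 1/2.
  · rw [measureReal_image_diff _ hE hA, measureReal_image_diff _ hE hW]
    have hn' : T ^ (-n) ∈ V := by
      rw [zpow_neg]
      exact hVinv _ hn
    have h1 : A ≤ᵐ[μ] (T ^ n)⁻¹.image W :=
      (Aut.image_inv_image (T ^ n) A).symm.le.trans
        (LE.le.eventuallyLE (Aut.image_mono _ (hsub n hn)))
    have h2 : (T ^ n)⁻¹.image A ≤ᵐ[μ] W := by
      have := hsub _ hn'
      rw [zpow_neg] at this
      exact LE.le.eventuallyLE this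
    have h3 := measureReal_diff_mono_ae (E := E) h1
    have h4 := measureReal_diff_mono_ae (E := E) h2
    have h5 : μ.real (E \ (T ^ n)⁻¹.image A) ≤ μ.real E :=
      measureReal_mono sdiff_subset (measure_ne_top _ _)
    have h6 : μ.real (E \ A) ≤ μ.real E := measureReal_mono sdiff_subset (measure_ne_top _ _)
    have h7 : 0 ≤ μ.real (E \ (T ^ n)⁻¹.image W) := measureReal_nonneg
    have h8 : 0 ≤ μ.real (E \ W) := measureReal_nonneg
    rw [abs_sub_le_iff]
    constructor <;> linarith

/-- If the mean of `h` over `P` is at most `a`, then `h ≤ a` on a nonnull part of `P`. -/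
theorem measure_le_pos_of_setIntegral_le {h : X → ℝ} (hint : Integrable h μ)
    {P : Set X} (hP0 : 0 < μ P) {a : ℝ}
    (ha : ∫ x in P, h x ∂μ ≤ a * μ.real P) : 0 < μ (P ∩ {x | h x ≤ a}) := by
  have h1 := measure_le_setAverage_pos hP0.ne' (measure_ne_top μ P) hint.integrableOn
  refine h1.trans_le (measure_mono fun x hx => ⟨hx.1, le_trans hx.2 ?_⟩)
  have hpos : 0 < μ.real P := measureReal_pos_iff_measure_pos.2 hP0
  rw [setAverage_eq, smul_eq_mul, inv_mul_le_iff₀ hpos, mul_comm]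
  exact ha

theorem measure_ge_pos_of_le_setIntegral {h : X → ℝ} (hint : Integrable h μ)
    {P : Set X} (hP0 : 0 < μ P) {a : ℝ}
    (ha : a * μ.real P ≤ ∫ x in P, h x ∂μ) : 0 < μ (P ∩ {x | a ≤ h x}) := by
  have h1 := measure_le_pos_of_setIntegral_le (a := -a) hint.neg hP0
    (by simp only [Pi.neg_apply]; rw [integral_neg]; linarith)
  simpa using h1

/-- An obstructed transformation is not whirly. -/
theorem not_isWhirly_of_mem_obstructed {T : Aut μ} {V : Set (Aut μ)} (hV : V ∈ 𝓝 (1 : Aut μ))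
    {P Q : Set X} (hP : MeasurableSet P) (hQ : MeasurableSet Q) (hP0 : 0 < μ P) (hQ0 : 0 < μ Q)
    (hT : T ∈ obstructed μ V P Q) : ¬ IsWhirly T := by
  intro hw
  rw [← Aut.mk_rep T] at hT
  obtain ⟨h, hm, -, -, hint, hlow, hhigh, hn⟩ := exists_density_of_mem_obstructed hP hQ hT
  -- Whirliness carries a nonnull part of `{h ≤ 1/8}` into `{7/8 ≤ h}` by a power in `V`, although
  -- such a power raises `h` by at most 1/2.
  obtain ⟨n, hnV, hpos⟩ := hw V hV _ _ (hP.inter (measurableSet_le hm measurable_const))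
    (hQ.inter (measurableSet_le measurable_const hm))
    (measure_le_pos_of_setIntegral_le hint hP0 hlow)
    (measure_ge_pos_of_le_setIntegral hint hQ0 hhigh)
  rw [← Aut.mk_rep_zpow] at hnV hpos
  refine hpos.ne' ?_
  have h1 : ∀ᵐ y ∂μ, h y ≤ h (((Aut.rep T ^ n : mpGroup μ) : Equiv.Perm X).symm y) + 1 / 2 := by
    filter_upwards [(mpGroup.mp_symm (Aut.rep T ^ n)).quasiMeasurePreserving.ae (hn n hnV)]
      with y hy
    rwa [Equiv.apply_symm_apply] at hy
  rw [measure_eq_zero_iff_ae_notMem]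
  filter_upwards [h1, (Aut.image_mk (Aut.rep T ^ n) (P ∩ {x | h x ≤ 1 / 8})).mem_iff]
    with y hy hy2 hy3
  rw [mem_inter_iff, hy2, Equiv.image_eq_preimage_symm] at hy3
  have h4 : h (((Aut.rep T ^ n : mpGroup μ) : Equiv.Perm X).symm y) ≤ 1 / 8 := hy3.1.2
  have h5 : 7 / 8 ≤ h y := hy3.2.2
  linarith

/-- The whirly transformations are those that are not obstructed. -/
theorem setOf_isWhirly_eq {A : ℕ → Set X} (hA : IsDenseSeparating μ A) :
    {T : Aut μ | IsWhirly T} = ⋂ (i : {i // 0 < μ (A i)}) (j : {j // 0 < μ (A j)}) (k : ℕ),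
      (obstructed μ (Aut.basicNhd μ A k) (A i) (A j))ᶜ := by
  ext T
  simp only [mem_ofPred_eq, mem_iInter, mem_compl_iff]
  constructor
  · exact fun hw i j k hT => not_isWhirly_of_mem_obstructed (Aut.basicNhd_mem_nhds hA k)
      (hA.measurableSet i) (hA.measurableSet j) i.2 j.2 hT hw
  · intro hT U hU P Q hP hQ hP0 hQ0
    by_contra! hcon
    obtain ⟨k, hk⟩ := Aut.exists_basicNhd_subset hA hU
    have key : ∀ P, MeasurableSet P → 0 < μ P →
        ∃ i, 0 < μ (A i) ∧ μ.real (P ∆ A i) ≤ 1 / 8 * μ.real (A i) := by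
      intro P hP hP0
      have hP0' : 0 < μ.real P := measureReal_pos_iff_measure_pos.2 hP0
      -- An error below one ninth of `P` leaves `A i` with more than eight ninths of the measure of
      -- `P`, so the error is at most one eighth of `A i`.
      obtain ⟨i, hi⟩ := hA.dense P hP (μ.real P / 9) (by positivity)
      have h1 := measureReal_inter_add_sdiff (μ := μ) (s := P) (hA.measurableSet i)
      have h2 : μ.real (P \ A i) ≤ μ.real (P ∆ A i) :=
        measureReal_mono subset_union_left (measure_ne_top _ _)
      have h3 : μ.real (P ∩ A i) ≤ μ.real (A i) :=
        measureReal_mono inter_subset_right (measure_ne_top _ _)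
      exact ⟨i, measureReal_pos_iff_measure_pos.1 (by linarith), by linarith⟩
    obtain ⟨i, hi0, hi⟩ := key P hP hP0
    obtain ⟨j, hj0, hj⟩ := key Q hQ hQ0
    exact hT ⟨i, hi0⟩ ⟨j, hj0⟩ k (mem_obstructed_of_image_inter_null (Aut.one_mem_basicNhd A k)
      (fun S => Aut.inv_mem_basicNhd hA) hP hQ (fun n hn => nonpos_iff_eq_zero.1 (hcon n (hk hn)))
      (hA.measurableSet j) hi hj)

end Whirly

/-! ### Isomorphisms of nonatomic standard spaces respecting finitely many labels. -/

namespace Whirly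

variable {X Y : Type*} [MeasurableSpace X] [MeasurableSpace Y]

theorem uncountable_of_nullSingletonClass (μ : Measure X) [NeZero μ] [NullSingletonClass μ] :
    Uncountable X := by
  rw [← not_countable_iff]
  intro h
  have : μ univ = 0 := (countable_univ (α := X)).measure_zero μ
  exact NeZero.ne μ (Measure.measure_univ_eq_zero.1 this)

/-- In a copy of the plane there are uncountably many disjoint vertical lines, and only countably
many can have positive mass. -/
theorem exists_not_countable_measure_zero [StandardBorelSpace X] [Uncountable X] (μ : Measure X)
    [IsFiniteMeasure μ] : ∃ N : Set X, MeasurableSet N ∧ ¬ N.Countable ∧ μ N = 0 := by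
  let e : X ≃ᵐ ℝ × ℝ := PolishSpace.measurableEquivOfNotCountable (not_countable_iff.2 ‹_›)
    (not_countable_iff.2 inferInstance)
  let s : ℝ → Set X := fun t => (fun x => (e x).1) ⁻¹' {t}
  have hs : ∀ t, MeasurableSet (s t) := fun t =>
    (measurable_fst.comp e.measurable) (measurableSet_singleton t)
  have hc : {t | 0 < μ (s t)}.Countable :=
    Measure.countable_meas_pos_of_disjoint_iUnion hs fun t u htu =>
      Disjoint.preimage _ (disjoint_singleton.2 htu)
  obtain ⟨t, ht⟩ : ∃ t, t ∉ {t | 0 < μ (s t)} := by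
    by_contra! hcon
    exact not_countable_univ (hc.mono fun t _ => hcon t)
  refine ⟨s t, hs t, fun hcount => ?_, nonpos_iff_eq_zero.1 (not_lt.1 ht)⟩
  have hinj : Function.Injective fun y : ℝ => e.symm (t, y) := fun y z hyz => by
    simpa using hyz
  refine not_countable_univ ((hcount.preimage hinj).mono fun y _ => ?_)
  simp [s]

/-- A measure preserving map between standard Borel spaces that is injective off a null set
agrees almost everywhere with a measurable equivalence. -/
theorem exists_measurableEquiv_ae_eq [StandardBorelSpace X] [StandardBorelSpace Y] [Uncountable X]
    [Uncountable Y] {μ : Measure X} {ν : Measure Y} [IsFiniteMeasure μ] [IsFiniteMeasure ν]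
    {f : X → Y} (hf : MeasurePreserving f μ ν) {N : Set X} (hN : μ N = 0) (hinj : InjOn f Nᶜ) :
    ∃ e : X ≃ᵐ Y, ∀ᵐ x ∂μ, e x = f x := by
  classical
  obtain ⟨N₁, hN₁m, hN₁c, hN₁⟩ := exists_not_countable_measure_zero μ
  obtain ⟨N₂, hN₂m, hN₂c, hN₂⟩ := exists_not_countable_measure_zero ν
  -- The null set removed is enlarged so that both leftovers, `B` and the complement of the range of
  -- `f` on `Bᶜ`, are uncountable, hence Borel isomorphic; the two pieces can then be glued.
  let B : Set X := toMeasurable μ N ∪ N₁ ∪ f ⁻¹' N₂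
  have hBm : MeasurableSet B :=
    ((measurableSet_toMeasurable _ _).union hN₁m).union (hf.measurable hN₂m)
  have hB0 : μ B = 0 := by
    refine measure_union_null (measure_union_null ((measure_toMeasurable N).trans hN) hN₁) ?_
    rw [hf.measure_preimage hN₂m.nullMeasurableSet, hN₂]
  have hBm' : MeasurableSet Bᶜ := hBm.compl
  have : StandardBorelSpace ↥(Bᶜ) := hBm'.standardBorel
  let g : ↥(Bᶜ) → Y := fun x => f x
  have hg : MeasurableEmbedding g := by
    refine (hf.measurable.comp measurable_subtype_coe).measurableEmbedding fun x y hxy => ?_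
    have hsub : Bᶜ ⊆ Nᶜ := compl_subset_compl.2 fun x hx =>
      Or.inl (Or.inl (subset_toMeasurable μ N hx))
    exact Subtype.ext (hinj (hsub x.2) (hsub y.2) hxy)
  have hR : MeasurableSet (range g) := hg.measurableSet_range
  have hRc : ¬ Countable ↥((range g)ᶜ) := by
    rw [countable_coe_iff]
    refine fun h => hN₂c (h.mono fun y hy => ?_)
    rintro ⟨x, rfl⟩
    exact x.2 (Or.inr hy)
  have hBc : ¬ Countable ↥(Bᶜᶜ) := by
    rw [countable_coe_iff, compl_compl]
    exact fun h => hN₁c (h.mono fun x hx => Or.inl (Or.inr hx))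
  have : StandardBorelSpace ↥(Bᶜᶜ) := hBm'.compl.standardBorel
  have : StandardBorelSpace ↥((range g)ᶜ) := hR.compl.standardBorel
  let e₂ : ↥(Bᶜᶜ) ≃ᵐ ↥((range g)ᶜ) := PolishSpace.measurableEquivOfNotCountable hBc hRc
  let e : X ≃ᵐ Y := (MeasurableEquiv.sumCompl hBm').symm.trans
    ((MeasurableEquiv.sumCongr hg.equivRange e₂).trans (MeasurableEquiv.sumCompl hR))
  refine ⟨e, ?_⟩
  have hae : ∀ᵐ x ∂μ, x ∈ Bᶜ := measure_eq_zero_iff_ae_notMem.1 hB0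
  filter_upwards [hae] with x hx
  have h1 : (MeasurableEquiv.sumCompl hBm').symm x = Sum.inl ⟨x, hx⟩ := by
    rw [MeasurableEquiv.symm_apply_eq]
    rfl
  change (MeasurableEquiv.sumCompl hR) ((MeasurableEquiv.sumCongr hg.equivRange e₂)
    ((MeasurableEquiv.sumCompl hBm').symm x)) = f x
  rw [h1]
  change (MeasurableEquiv.sumCompl hR) (Sum.inl (hg.equivRange ⟨x, hx⟩)) = f x
  rw [hg.equivRange_apply]
  rfl

section Cdf

variable (ρ : Measure ℝ) [IsFiniteMeasure ρ]

theorem monotone_measureReal_Iic : Monotone fun t => ρ.real (Iic t) := fun _ _ h =>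
  measureReal_mono (Iic_subset_Iic.2 h) (measure_ne_top _ _)

theorem tendsto_measureReal_Iic_atTop :
    Tendsto (fun t => ρ.real (Iic t)) atTop (𝓝 (ρ.real univ)) :=
  (ENNReal.tendsto_toReal (measure_ne_top _ _)).comp (tendsto_measure_Iic_atTop ρ)

/-- Dominated convergence for indicators. It serves twice: `E` empty for the limit at `-∞`, `E = Iic
t` for continuity at `t`. -/
theorem tendsto_measureReal_Iic_of_ae {l : Filter ℝ} [l.IsCountablyGenerated] {E : Set ℝ}
    (hE : MeasurableSet E) (h : ∀ᵐ x ∂ρ, ∀ᶠ t in l, x ≤ t ↔ x ∈ E) :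
    Tendsto (fun t => ρ.real (Iic t)) l (𝓝 (ρ.real E)) := by
  have h1 : ∀ t, ρ.real (Iic t) = ∫ x, (Iic t).indicator (fun _ => (1 : ℝ)) x ∂ρ := fun t => by
    rw [integral_indicator_const _ measurableSet_Iic, smul_eq_mul, mul_one]
  have h2 : ρ.real E = ∫ x, E.indicator (fun _ => (1 : ℝ)) x ∂ρ := by
    rw [integral_indicator_const _ hE, smul_eq_mul, mul_one]
  simp only [h1, h2]
  refine tendsto_integral_filter_of_dominated_convergence (fun _ => 1)
    (Eventually.of_forall fun t =>
      (measurable_const.indicator measurableSet_Iic).aestronglyMeasurable)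
    (Eventually.of_forall fun t => Eventually.of_forall fun x => ?_) (integrable_const _) ?_
  · by_cases hx : x ∈ Iic t <;> simp [hx]
  · filter_upwards [h] with x hx
    refine tendsto_const_nhds.congr' ?_
    filter_upwards [hx] with t ht
    have ht' : x ∈ Iic t ↔ x ∈ E := ht
    by_cases hxE : x ∈ E <;> simp [hxE, ht']

theorem tendsto_measureReal_Iic_atBot : Tendsto (fun t => ρ.real (Iic t)) atBot (𝓝 0) := by
  have := tendsto_measureReal_Iic_of_ae ρ (l := atBot) MeasurableSet.empty
    (Eventually.of_forall fun x => by
      filter_upwards [eventually_lt_atBot x] with t ht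
      simpa using ht)
  simpa using this

variable [NullSingletonClass ρ]

theorem continuous_measureReal_Iic : Continuous fun t => ρ.real (Iic t) := by
  rw [continuous_iff_continuousAt]
  intro t
  refine tendsto_measureReal_Iic_of_ae ρ measurableSet_Iic ?_
  filter_upwards [measure_eq_zero_iff_ae_notMem.1 (measure_singleton (μ := ρ) t)] with x hx
  rcases lt_or_gt_of_ne (fun h => hx (mem_singleton_iff.2 h)) with h | h
  · filter_upwards [lt_mem_nhds h] with u hu
    exact iff_of_true hu.le h.le
  · filter_upwards [gt_mem_nhds h] with u hu
    exact iff_of_false (not_le.2 hu) (not_le.2 h)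

/-- The distribution function of a measure without atoms transports it to Lebesgue measure on an
interval. -/
theorem map_measureReal_Iic :
    ρ.map (fun t => ρ.real (Iic t)) = volume.restrict (Icc 0 (ρ.real univ)) := by
  set F := fun t => ρ.real (Iic t) with hF
  set m := ρ.real univ with hm
  have hmono : Monotone F := monotone_measureReal_Iic ρ
  have hFm : Measurable F := hmono.measurable
  -- By continuity `F t = s` for some `t`; the half-line `Iic t`, of mass `s`, contains `{F < s}`
  -- and is contained in `{F ≤ s}`.
  have hle : ∀ s, 0 < s → s < m → s ≤ ρ.real {x | F x ≤ s} ∧ ρ.real {x | F x < s} ≤ s := by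
    intro s hs0 hsm
    obtain ⟨a, ha⟩ := ((tendsto_measureReal_Iic_atBot ρ).eventually (gt_mem_nhds hs0)).exists
    obtain ⟨b, hb⟩ := ((tendsto_measureReal_Iic_atTop ρ).eventually (lt_mem_nhds hsm)).exists
    obtain ⟨t, ht⟩ := mem_range_of_exists_le_of_exists_ge (continuous_measureReal_Iic ρ)
      ⟨a, ha.le⟩ ⟨b, hb.le⟩
    have ht' : F t = s := ht
    constructor
    · rw [← ht']
      exact measureReal_mono (fun x hx => hmono hx) (measure_ne_top _ _)
    · conv_rhs => rw [← ht']
      refine measureReal_mono (fun x hx => ?_) (measure_ne_top _ _)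
      by_contra hcon
      exact absurd (hmono (not_le.1 hcon).le) (not_le.2 (ht' ▸ hx))
  have heq : ∀ s, ρ.real {x | F x ≤ s} = max 0 (min s m) := by
    intro s
    have hFle : ∀ x, F x ≤ m := fun x => measureReal_mono (subset_univ _) (measure_ne_top _ _)
    have hm0 : 0 ≤ m := measureReal_nonneg
    rcases lt_or_ge s 0 with hs | hs
    · have : {x | F x ≤ s} = ∅ := by
        ext x
        simp only [mem_ofPred_eq, mem_empty_iff_false, iff_false, not_le]
        exact hs.trans_le measureReal_nonneg
      rw [this, measureReal_empty, max_eq_left ((min_le_left _ _).trans hs.le)]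
    rcases le_or_gt m s with hms | hms
    · have : {x | F x ≤ s} = univ := by
        ext x
        simp [(hFle x).trans hms]
      rw [this, min_eq_right hms, max_eq_right hm0]
    · rw [min_eq_left hms.le, max_eq_right hs]
      refine le_antisymm (le_of_forall_gt_imp_ge_of_dense fun u hu => ?_) ?_
      · rcases lt_or_ge u m with hum | hum
        · refine le_trans ?_ (hle u (hs.trans_lt hu) hum).2
          exact measureReal_mono (fun x hx => lt_of_le_of_lt hx hu) (measure_ne_top _ _)
        · exact (measureReal_mono (subset_univ _) (measure_ne_top _ _)).trans hum
      · rcases hs.eq_or_lt with rfl | hs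
        · exact measureReal_nonneg
        · exact (hle s hs hms).1
  refine Measure.ext_of_Iic _ _ fun s => ?_
  rw [Measure.map_apply hFm measurableSet_Iic, Measure.restrict_apply measurableSet_Iic,
    ← ENNReal.ofReal_toReal (measure_ne_top ρ _)]
  have h1 : (ρ (F ⁻¹' Iic s)).toReal = max 0 (min s m) := heq s
  have h2 : Iic s ∩ Icc 0 m = Icc 0 (min s m) := by
    ext x
    simp only [mem_inter_iff, mem_Iic, mem_Icc, le_min_iff]
    tauto
  rw [h1, h2, Real.volume_Icc, sub_zero]
  rcases le_total 0 (min s m) with h | h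
  · rw [max_eq_right h]
  · rw [max_eq_left h, ENNReal.ofReal_zero, ENNReal.ofReal_of_nonpos h]

/-- If `F` agrees at `x < y`, it takes the same value at a rational between them. The countably many
level sets through rationals are null, the image measure being Lebesgue. -/
theorem exists_null_injOn_measureReal_Iic :
    ∃ N : Set ℝ, MeasurableSet N ∧ ρ N = 0 ∧ InjOn (fun t => ρ.real (Iic t)) Nᶜ := by
  set F := fun t => ρ.real (Iic t) with hF
  have hFm : Measurable F := (monotone_measureReal_Iic ρ).measurable
  refine ⟨⋃ p : ℚ, F ⁻¹' {F p}, MeasurableSet.iUnion fun p => hFm (measurableSet_singleton _),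
    measure_iUnion_null fun p => ?_, ?_⟩
  · rw [← Measure.map_apply hFm (measurableSet_singleton _), hF, map_measureReal_Iic]
    exact measure_singleton _
  · have key : ∀ x y, x < y → F x = F y → x ∈ ⋃ p : ℚ, F ⁻¹' {F p} := by
      intro x y hxy h
      obtain ⟨p, hxp, hpy⟩ := exists_rat_btwn hxy
      refine mem_iUnion.2 ⟨p, le_antisymm (monotone_measureReal_Iic ρ hxp.le) ?_⟩
      rw [h]
      exact monotone_measureReal_Iic ρ hpy.le
    intro x hx y hy hxy
    by_contra hne
    rcases lt_or_gt_of_ne hne with h | h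
    · exact hx (key x y h hxy)
    · exact hy (key y x h hxy.symm)

end Cdf

section Label

variable {ι : Type*} [Finite ι] [MeasurableSpace ι] [DiscreteMeasurableSpace ι]

/-- A standard model of a nonatomic measure with a finite labelling. -/
noncomputable def labelModel (p : ι → ℝ) : Measure (ι × ℝ) :=
  Measure.sum fun a => (volume.restrict (Icc 0 (p a))).map fun t => (a, t)

/-- A point is sent to its label together with the distribution function of its own label class,
read through an embedding into the line. -/
theorem exists_measurePreserving_labelModel [StandardBorelSpace X] (μ : Measure X)
    [IsFiniteMeasure μ] [NullSingletonClass μ] {l : X → ι} (hl : Measurable l) :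
    ∃ g : X → ι × ℝ, MeasurePreserving g μ (labelModel fun a => μ.real (l ⁻¹' {a})) ∧
      (∀ x, (g x).1 = l x) ∧ ∃ N, μ N = 0 ∧ InjOn g Nᶜ := by
  let e := embeddingReal X
  have he : MeasurableEmbedding e := measurableEmbedding_embeddingReal X
  let ρ : ι → Measure ℝ := fun a => (μ.restrict (l ⁻¹' {a})).map e
  have hfib : ∀ a, MeasurableSet (l ⁻¹' {a}) := fun a => hl (measurableSet_singleton a)
  have hρ : ∀ a, NullSingletonClass (ρ a) := fun a => ⟨fun t => by
    rw [Measure.map_apply he.measurable (measurableSet_singleton t)]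
    refine (Set.Subsingleton.measure_zero ?_ _)
    intro x hx y hy
    exact he.injective ((hx : e x = t).trans (hy : e y = t).symm)⟩
  let F : ι → ℝ → ℝ := fun a t => (ρ a).real (Iic t)
  have hFm : ∀ a, Measurable (F a) := fun a => (monotone_measureReal_Iic (ρ a)).measurable
  have hF : Measurable fun q : ι × ℝ => F q.1 q.2 := measurable_from_prod_countable_right hFm
  let g : X → ι × ℝ := fun x => (l x, F (l x) (e x))
  have hg : Measurable g := hl.prodMk (hF.comp (hl.prodMk he.measurable))
  refine ⟨g, ⟨hg, ?_⟩, fun _ => rfl, ?_⟩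
  · have hsum : μ = Measure.sum fun a => μ.restrict (l ⁻¹' {a}) := by
      rw [← Measure.restrict_iUnion _ hfib]
      · rw [← preimage_iUnion, iUnion_of_singleton, preimage_univ, Measure.restrict_univ]
      · intro a b hab
        exact Disjoint.preimage _ (disjoint_singleton.2 hab)
    conv_lhs => rw [hsum]
    rw [Measure.map_sum hg.aemeasurable, labelModel]
    congr 1
    funext a
    have h1 : (ρ a).real univ = μ.real (l ⁻¹' {a}) := by
      rw [map_measureReal_apply he.measurable MeasurableSet.univ]
      simp [measureReal_restrict_apply]
    rw [← h1, ← map_measureReal_Iic (ρ a), Measure.map_map (hFm a) he.measurable,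
      Measure.map_map measurable_prodMk_left ((hFm a).comp he.measurable)]
    refine Measure.map_congr ?_
    filter_upwards [ae_restrict_mem (hfib a)] with x hx
    have hx' : l x = a := hx
    simp [g, F, hx']
  · choose N hNm hN hinj using fun a => exists_null_injOn_measureReal_Iic (ρ a)
    refine ⟨⋃ a, l ⁻¹' {a} ∩ e ⁻¹' N a, measure_iUnion_null fun a => ?_, ?_⟩
    · have := hN a
      rwa [Measure.map_apply he.measurable (hNm a),
        Measure.restrict_apply (he.measurable (hNm a)), inter_comm] at this
    · intro x hx y hy hxy
      have h1 : l x = l y := congrArg Prod.fst hxy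
      have h2 : F (l x) (e x) = F (l y) (e y) := congrArg Prod.snd hxy
      rw [h1] at h2
      refine he.injective (hinj (l y) ?_ ?_ h2)
      · exact fun h => hx (mem_iUnion.2 ⟨l y, h1, h⟩)
      · exact fun h => hy (mem_iUnion.2 ⟨l y, rfl, h⟩)

/-- Isomorphism of nonatomic standard probability spaces, respecting a finite labelling. -/
theorem exists_measurableEquiv_label [StandardBorelSpace X] [StandardBorelSpace Y]
    {μ : Measure X} {ν : Measure Y} [IsProbabilityMeasure μ] [IsProbabilityMeasure ν]
    [NullSingletonClass μ] [NullSingletonClass ν] {ψ : Y → X} (hψ : MeasurePreserving ψ ν μ)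
    {l : X → ι} (hl : Measurable l) :
    ∃ θ : Y ≃ᵐ X, MeasurePreserving θ ν μ ∧ ∀ᵐ y ∂ν, l (θ y) = l (ψ y) := by
  have := uncountable_of_nullSingletonClass μ
  have := uncountable_of_nullSingletonClass ν
  obtain ⟨g, hg, hgl, N, hN, hinj⟩ := exists_measurePreserving_labelModel μ hl
  obtain ⟨g', hg', hgl', N', hN', hinj'⟩ :=
    exists_measurePreserving_labelModel ν (hl.comp hψ.measurable)
  -- The label classes have equal masses on both sides, so both spaces have the same model; nothing
  -- else about `ψ` matters.
  have hp : (fun a => ν.real (l ∘ ψ ⁻¹' {a})) = fun a => μ.real (l ⁻¹' {a}) := by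
    funext a
    rw [preimage_comp, Measure.real, Measure.real,
      hψ.measure_preimage (hl (measurableSet_singleton a)).nullMeasurableSet]
  rw [hp] at hg'
  have hfin : IsFiniteMeasure (labelModel fun a => μ.real (l ⁻¹' {a})) := by
    rw [← hg.map_eq]
    infer_instance
  have : Nonempty ι := ⟨l (nonempty_of_isProbabilityMeasure μ).some⟩
  have : Uncountable (ι × ℝ) := inferInstance
  obtain ⟨e, he⟩ := exists_measurableEquiv_ae_eq hg hN hinj
  obtain ⟨e', he'⟩ := exists_measurableEquiv_ae_eq hg' hN' hinj'
  have hemp : MeasurePreserving e μ (labelModel fun a => μ.real (l ⁻¹' {a})) :=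
    ⟨e.measurable, by rw [Measure.map_congr he, hg.map_eq]⟩
  have hemp' : MeasurePreserving e' ν (labelModel fun a => μ.real (l ⁻¹' {a})) :=
    ⟨e'.measurable, by rw [Measure.map_congr he', hg'.map_eq]⟩
  have hθ := (hemp.symm e).comp hemp'
  refine ⟨e'.trans e.symm, hθ, ?_⟩
  filter_upwards [he', hθ.quasiMeasurePreserving.ae he] with y h1 h2
  have h3 : e (e.symm (e' y)) = g (e.symm (e' y)) := h2
  rw [MeasurableEquiv.apply_symm_apply, h1] at h3
  have h4 := congrArg Prod.fst h3
  rw [hgl', hgl] at h4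
  rw [MeasurableEquiv.trans_apply, h1]
  exact h4.symm

end Label

end Whirly

/-! ### Limits of automorphisms on a dense separating sequence. -/

namespace Whirly

variable {X : Type*} [MeasurableSpace X] {μ : Measure X}

section Code

/-- The code of a point given by a sequence of sets. -/
def codeMap (A : ℕ → Set X) (x : X) : ℕ → Prop := fun i => x ∈ A i

theorem measurable_codeMap {A : ℕ → Set X} (hA : ∀ i, MeasurableSet (A i)) :
    Measurable (codeMap A) :=
  measurable_pi_iff.2 fun i => measurable_mem.2 (hA i)

theorem measurableSet_cylinder (J : Finset ℕ) : MeasurableSet {y : ℕ → Prop | ∀ i ∈ J, y i} := by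
  have : {y : ℕ → Prop | ∀ i ∈ J, y i} = ⋂ i ∈ J, {y | y i} := by
    ext y
    simp
  rw [this]
  exact Finset.measurableSet_biInter _ fun i _ => measurableSet_setOfPred.2 (measurable_pi_apply i)

theorem measure_ext_of_cylinders {κ κ' : Measure (ℕ → Prop)} [IsFiniteMeasure κ]
    (h : ∀ J : Finset ℕ, κ {y | ∀ i ∈ J, y i} = κ' {y | ∀ i ∈ J, y i}) : κ = κ' := by
  refine ext_of_generate_finite (range fun J : Finset ℕ => {y : ℕ → Prop | ∀ i ∈ J, y i})
    (le_antisymm ?_ ?_) ?_ ?_ ?_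
  · refine iSup_le fun i => ?_
    rw [← measurable_iff_comap_le]
    refine @measurable_to_prop _ (MeasurableSpace.generateFrom _) _
      (MeasurableSpace.measurableSet_generateFrom ⟨{i}, ?_⟩)
    ext y
    simp
  · refine MeasurableSpace.generateFrom_le ?_
    rintro _ ⟨J, rfl⟩
    exact measurableSet_cylinder J
  · rintro _ ⟨J, rfl⟩ _ ⟨K, rfl⟩ -
    refine ⟨J ∪ K, ?_⟩
    ext y
    simp [or_imp, forall_and]
  · rintro _ ⟨J, rfl⟩
    exact h J
  · have := h ∅
    simpa using this

end Code

variable [IsProbabilityMeasure μ] {A : ℕ → Set X}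

theorem symmDiff_biInter_subset {ι : Type*} (J : Finset ι) (B C : ι → Set X) :
    (⋂ i ∈ J, B i) ∆ (⋂ i ∈ J, C i) ⊆ ⋃ i ∈ J, B i ∆ C i := by
  intro x hx
  simp only [mem_symmDiff, mem_iInter, mem_iUnion, not_forall] at hx ⊢
  rcases hx with ⟨h1, i, hi, h2⟩ | ⟨h1, i, hi, h2⟩
  · exact ⟨i, hi, Or.inl ⟨h1 i hi, h2⟩⟩
  · exact ⟨i, hi, Or.inr ⟨h1 i hi, h2⟩⟩

theorem abs_measureReal_sub_le {E F : Set X} (hE : MeasurableSet E) (hF : MeasurableSet F) :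
    |μ.real E - μ.real F| ≤ μ.real (E ∆ F) :=
  IsDominatedContent.abs_sub_le (φ := μ.real)
    ⟨fun _ _ => measureReal_nonneg, fun _ _ => le_rfl, fun _ _ _ hF hd => measureReal_union hd hF⟩
    hE hF

/-- If the images of the sets of a dense separating sequence converge in the measure algebra, then
the limit is given by a measure preserving map. -/
theorem exists_limit_map [StandardBorelSpace X] (hA : IsDenseSeparating μ A) {ι : Type*}
    {l : Filter ι} [l.NeBot] {S : ι → Aut μ} {B : ℕ → Set X} (hB : ∀ i, MeasurableSet (B i))
    (h : ∀ i, Tendsto (fun k => μ.real (B i ∆ (S k).image (A i))) l (𝓝 0)) :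
    ∃ φ : X → X, MeasurePreserving φ μ μ ∧ ∀ E, MeasurableSet E →
      Tendsto (fun k => μ.real ((φ ⁻¹' E) ∆ (S k).image E)) l (𝓝 0) := by
  have hc : MeasurableEmbedding (codeMap A) :=
    (measurable_codeMap hA.measurableSet).measurableEmbedding fun x y hxy =>
      hA.separates x y fun i => iff_of_eq (congrFun hxy i)
  have hg := measurable_codeMap hB
  -- Each finite intersection of the `B i` is a limit of images of the corresponding intersection of
  -- the `A i`, so has its measure. Codes by `B` thus almost surely lie in the range of the
  -- injective `codeMap A` and can be decoded.
  have hlaw : μ.map (codeMap B) = μ.map (codeMap A) := by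
    refine measure_ext_of_cylinders fun J => ?_
    have hpre : ∀ D : ℕ → Set X, codeMap D ⁻¹' {y | ∀ i ∈ J, y i} = ⋂ i ∈ J, D i := by
      intro D
      ext x
      simp [codeMap]
    rw [Measure.map_apply hg (measurableSet_cylinder J),
      Measure.map_apply hc.measurable (measurableSet_cylinder J), hpre, hpre,
      ← measureReal_eq_measureReal_iff]
    have hmB : MeasurableSet (⋂ i ∈ J, B i) := Finset.measurableSet_biInter _ fun i _ => hB i
    have hmA : MeasurableSet (⋂ i ∈ J, A i) :=
      Finset.measurableSet_biInter _ fun i _ => hA.measurableSet i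
    have him : ∀ k, (S k).image (⋂ i ∈ J, A i) = ⋂ i ∈ J, (S k).image (A i) := by
      intro k
      simp only [Aut.image, Equiv.image_eq_preimage_symm, preimage_iInter]
    have hlim : Tendsto (fun k => ∑ i ∈ J, μ.real (B i ∆ (S k).image (A i))) l (𝓝 0) := by
      simpa using tendsto_finsetSum J fun i _ => h i
    have hle : |μ.real (⋂ i ∈ J, B i) - μ.real (⋂ i ∈ J, A i)| ≤ 0 := by
      refine ge_of_tendsto' hlim fun k => ?_
      rw [← Aut.measureReal_image (S k) hmA]
      refine (abs_measureReal_sub_le hmB (Aut.measurableSet_image _ hmA)).trans ?_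
      rw [him]
      exact (measureReal_mono (symmDiff_biInter_subset J _ _) (measure_ne_top _ _)).trans
        (measureReal_biUnion_finset_le J _)
    linarith [abs_nonpos_iff.1 hle]
  have hne : Nonempty X := nonempty_of_isProbabilityMeasure μ
  let φ : X → X := fun x => hc.invFun (codeMap B x)
  have hφm : Measurable φ := hc.measurable_invFun.comp hg
  have hφ : MeasurePreserving φ μ μ := by
    refine ⟨hφm, ?_⟩
    have : μ.map φ = (μ.map (codeMap B)).map hc.invFun :=
      (Measure.map_map hc.measurable_invFun hg).symm
    rw [this, hlaw, Measure.map_map hc.measurable_invFun hc.measurable]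
    have : hc.invFun ∘ codeMap A = id := funext hc.leftInverse_invFun
    rw [this, Measure.map_id]
  have hrange : ∀ᵐ x ∂μ, codeMap A (φ x) = codeMap B x := by
    have h1 : ∀ᵐ y ∂μ.map (codeMap B), y ∈ range (codeMap A) := by
      rw [hlaw]
      exact (ae_map_iff hc.measurable.aemeasurable hc.measurableSet_range).2
        (Eventually.of_forall fun x => mem_range_self x)
    filter_upwards [ae_of_ae_map hg.aemeasurable h1] with x hx
    obtain ⟨z, hz⟩ := hx
    change codeMap A (hc.invFun (codeMap B x)) = codeMap B x
    rw [← hz, hc.leftInverse_invFun]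
  have hpre : ∀ i, (φ ⁻¹' A i : Set X) =ᵐ[μ] B i := by
    intro i
    rw [Filter.eventuallyEq_set]
    filter_upwards [hrange] with x hx
    exact iff_of_eq (congrFun hx i)
  refine ⟨φ, hφ, fun E hE => ?_⟩
  rw [Metric.tendsto_nhds]
  intro ε hε
  obtain ⟨i, hi⟩ := hA.dense E hE (ε / 3) (by positivity)
  filter_upwards [(Metric.tendsto_nhds.1 (h i)) (ε / 3) (by positivity)] with j hj
  rw [Real.dist_0_eq_abs, abs_of_nonneg measureReal_nonneg] at hj ⊢
  have hAi := hA.measurableSet i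
  have h1 := measureReal_symmDiff_le (μ := μ) (s := φ ⁻¹' E) (t := φ ⁻¹' A i) ((S j).image E)
  have h2 := measureReal_symmDiff_le (μ := μ) (s := φ ⁻¹' A i) (t := (S j).image (A i))
    ((S j).image E)
  rw [Aut.measureReal_image_symmDiff (S j) hAi hE, symmDiff_comm (A i),
    measureReal_symmDiff_congr_left (hpre i) ((S j).image (A i))] at h2
  have h3 : μ.real ((φ ⁻¹' E) ∆ (φ ⁻¹' A i)) = μ.real (E ∆ A i) := by
    rw [← Set.preimage_symmDiff, Measure.real,
      hφ.measure_preimage (hE.symmDiff hAi).nullMeasurableSet, Measure.real]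
  linarith

/-- Two-sided convergence on a dense separating sequence implies convergence in `Aut μ`. -/
theorem exists_tendsto_aut [StandardBorelSpace X] [NullSingletonClass μ]
    (hA : IsDenseSeparating μ A) {ι : Type*}
    {l : Filter ι} [l.NeBot] {S : ι → Aut μ} {B B' : ℕ → Set X} (hB : ∀ i, MeasurableSet (B i))
    (hB' : ∀ i, MeasurableSet (B' i))
    (h : ∀ i, Tendsto (fun k => μ.real (B i ∆ (S k).image (A i))) l (𝓝 0))
    (h' : ∀ i, Tendsto (fun k => μ.real (B' i ∆ (S k)⁻¹.image (A i))) l (𝓝 0)) :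
    ∃ T, Tendsto S l (𝓝 T) := by
  obtain ⟨φ, hφ, hlim⟩ := exists_limit_map hA hB h
  obtain ⟨φ', hφ', hlim'⟩ := exists_limit_map hA (S := fun k => (S k)⁻¹) hB' h'
  have hinv : ∀ E, MeasurableSet E → (φ' ⁻¹' (φ ⁻¹' E) : Set X) =ᵐ[μ] E := by
    intro E hE
    have hE1 := hφ.measurable hE
    have h0 : μ.real ((φ' ⁻¹' (φ ⁻¹' E)) ∆ E) ≤ 0 := by
      have hsum := (hlim' _ hE1).add (hlim E hE)
      rw [add_zero] at hsum
      refine ge_of_tendsto' hsum fun k => ?_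
      refine (measureReal_symmDiff_le (t := (S k)⁻¹.image (φ ⁻¹' E)) E).trans
        (add_le_add_right (le_of_eq ?_) _)
      rw [← measureReal_symmDiff_congr_right _ (Aut.image_inv_image (S k) E),
        Aut.measureReal_image_symmDiff _ hE1 (Aut.measurableSet_image _ hE)]
    rw [← measure_symmDiff_eq_zero_iff]
    exact (measureReal_eq_zero_iff (measure_ne_top _ _)).1 (le_antisymm h0 measureReal_nonneg)
  -- One composition suffices: it makes `φ'` injective off a null set, hence almost everywhere equal
  -- to an equivalence, whose inverse is then almost everywhere `φ`.
  have hid : ∀ᵐ x ∂μ, φ (φ' x) = x := by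
    have := ae_all_iff.2 fun i => Filter.eventuallyEq_set.1 (hinv _ (hA.measurableSet i))
    filter_upwards [this] with x hx
    exact hA.separates _ _ hx
  have := uncountable_of_nullSingletonClass μ
  obtain ⟨e, he⟩ := exists_measurableEquiv_ae_eq hφ' (N := {x | φ (φ' x) = x}ᶜ) hid
    (fun x hx y hy hxy => by
      rw [compl_compl] at hx hy
      have hx' : φ (φ' x) = x := hx
      rw [← hx', hxy]
      exact hy)
  have hemp : MeasurePreserving e μ μ := ⟨e.measurable, by rw [Measure.map_congr he, hφ'.map_eq]⟩
  let f : mpGroup μ := ⟨e.toEquiv, hemp, hemp.symm e⟩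
  refine ⟨Aut.mk μ f, Aut.tendsto_iff_measureReal.2 fun E hE => ?_⟩
  have hsymm : ∀ᵐ x ∂μ, e.symm x = φ x := by
    have h1 : ∀ᵐ x ∂μ, e.symm (e x) = φ (e x) := by
      filter_upwards [he, hid] with x h1 h2
      rw [MeasurableEquiv.symm_apply_apply, h1, h2]
    filter_upwards [(hemp.symm e).quasiMeasurePreserving.ae h1] with x hx
    rwa [MeasurableEquiv.apply_symm_apply] at hx
  have himage : (Aut.mk μ f).image E =ᵐ[μ] (φ ⁻¹' E : Set X) := by
    refine (Aut.image_mk f E).trans ?_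
    rw [Equiv.image_eq_preimage_symm, Filter.eventuallyEq_set]
    filter_upwards [hsymm] with x hx
    change e.symm x ∈ E ↔ φ x ∈ E
    rw [hx]
  simp only [measureReal_symmDiff_congr_left himage]
  exact hlim E hE

end Whirly

/-! ### Complete metrizability of `Aut μ`. -/

namespace Whirly

variable {X : Type*} [MeasurableSpace X] {μ : Measure X} [IsProbabilityMeasure μ]

/-- The class in `L¹` of the indicator function of a measurable set. -/
noncomputable def indicatorLp (μ : Measure X) [IsProbabilityMeasure μ] {E : Set X}
    (hE : MeasurableSet E) : Lp ℝ 1 μ :=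
  indicatorConstLp 1 hE (measure_ne_top μ E) 1

theorem dist_indicatorLp {E F : Set X} (hE : MeasurableSet E) (hF : MeasurableSet F) :
    dist (indicatorLp μ hE) (indicatorLp μ hF) = μ.real (E ∆ F) := by
  rw [indicatorLp, indicatorLp, dist_indicatorConstLp_eq_norm, norm_indicatorConstLp (by simp) (by simp)]
  simp

/-- Where the cut of `f` at level 1/2 differs from `E`, the functions are at least 1/2 apart;
Markov's inequality does the rest. -/
theorem measureReal_symmDiff_le_dist {E : Set X} (hE : MeasurableSet E) (f : Lp ℝ 1 μ) :
    μ.real ({x | 1 / 2 ≤ f x} ∆ E) ≤ 2 * dist (indicatorLp μ hE) f := by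
  have hint : Integrable (fun x => ‖f x - indicatorLp μ hE x‖) μ :=
    ((L1.integrable_coeFn f).sub (L1.integrable_coeFn _)).norm
  have h1 := mul_meas_ge_le_integral_of_nonneg
    (Eventually.of_forall fun x => norm_nonneg (f x - indicatorLp μ hE x)) hint (1 / 2)
  have h2 : dist (indicatorLp μ hE) f = ∫ x, ‖f x - indicatorLp μ hE x‖ ∂μ := by
    rw [dist_comm, dist_eq_norm, L1.norm_eq_integral_norm]
    refine integral_congr_ae ?_
    filter_upwards [Lp.coeFn_sub f (indicatorLp μ hE)] with x hx
    rw [hx, Pi.sub_apply]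
  have h3 : μ.real ({x | 1 / 2 ≤ f x} ∆ E) ≤
      μ.real {x | 1 / 2 ≤ ‖f x - indicatorLp μ hE x‖} := by
    refine ENNReal.toReal_mono (measure_ne_top _ _) (measure_mono_ae ?_)
    filter_upwards [indicatorConstLp_coeFn (p := 1) (hs := hE) (hμs := measure_ne_top μ E)
      (c := (1 : ℝ))] with x hx hxE
    have hx' : indicatorLp μ hE x = E.indicator (fun _ => 1) x := hx
    change 1 / 2 ≤ ‖f x - indicatorLp μ hE x‖
    rw [hx', Real.norm_eq_abs]
    rcases hxE with ⟨h4, h5⟩ | ⟨h4, h5⟩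
    · have h4' : 1 / 2 ≤ f x := h4
      rw [indicator_of_notMem h5, sub_zero]
      exact h4'.trans (le_abs_self _)
    · have h5' : f x < 1 / 2 := not_le.1 h5
      rw [indicator_of_mem h4, abs_sub_comm]
      exact le_trans (by linarith) (le_abs_self _)
  have h4 : (1 / 2 : ℝ) * μ.real {x | 1 / 2 ≤ ‖f x - indicatorLp μ hE x‖} ≤
      dist (indicatorLp μ hE) f := h2 ▸ h1
  linarith

namespace Aut

/-- The images of a sequence of sets under a transformation and its inverse, as elements of
`L¹`. -/
noncomputable def imageSeq {A : ℕ → Set X} (hA : ∀ i, MeasurableSet (A i)) (T : Aut μ) (i : ℕ) :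
    Lp ℝ 1 μ × Lp ℝ 1 μ :=
  (indicatorLp μ (measurableSet_image T (hA i)), indicatorLp μ (measurableSet_image T⁻¹ (hA i)))

variable {A : ℕ → Set X}

theorem continuous_imageSeq (hA : ∀ i, MeasurableSet (A i)) :
    Continuous (imageSeq (μ := μ) hA) := by
  have key : ∀ i, Continuous fun T : Aut μ => indicatorLp μ (measurableSet_image T (hA i)) := by
    intro i
    rw [continuous_iff_continuousAt]
    intro T
    rw [ContinuousAt, tendsto_iff_dist_tendsto_zero]
    simp only [dist_indicatorLp, symmDiff_comm _ (image T (A i))]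
    exact tendsto_iff_measureReal.1 tendsto_id _ (hA i)
  exact continuous_pi fun i => (key i).prodMk ((key i).comp continuous_inv)

theorem tendsto_of_tendsto_imageSeq (hA : IsDenseSeparating μ A) {ι : Type*} {l : Filter ι}
    {S : ι → Aut μ} {T : Aut μ} (h : Tendsto (fun k => imageSeq hA.measurableSet (S k)) l
      (𝓝 (imageSeq hA.measurableSet T))) : Tendsto S l (𝓝 T) := by
  refine tendsto_of_isDenseSeparating hA fun i => ?_
  have h1 := ((continuous_fst.comp (continuous_apply i)).tendsto _).comp h
  rw [tendsto_iff_dist_tendsto_zero] at h1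
  refine h1.congr fun k => ?_
  simp only [Function.comp, imageSeq, dist_indicatorLp]
  rw [symmDiff_comm]

theorem injective_imageSeq (hA : IsDenseSeparating μ A) :
    Function.Injective (imageSeq (μ := μ) hA.measurableSet) := by
  intro T T' h
  have h1 : ∀ i, image T (A i) =ᵐ[μ] image T' (A i) := by
    intro i
    rw [← measure_symmDiff_eq_zero_iff, ← measureReal_eq_zero_iff (measure_ne_top _ _),
      ← dist_indicatorLp (measurableSet_image T (hA.measurableSet i))
        (measurableSet_image T' (hA.measurableSet i)), dist_eq_zero]
    exact congrArg Prod.fst (congrFun h i)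
  rw [← inv_inj, ← mk_rep T, ← mk_rep T', ← map_inv, ← map_inv, mk_eq_mk]
  have h2 := ae_all_iff.2 fun i => Filter.eventuallyEq_set.1 (h1 i)
  filter_upwards [h2] with x hx
  refine hA.separates _ _ fun i => ?_
  have := hx i
  rw [image, image, Equiv.image_eq_preimage_symm, Equiv.image_eq_preimage_symm] at this
  exact this

/-- Limits in `L¹`, cut at level 1/2, yield limit sets, and these come from an automorphism. Images
under inverses are recorded too because the limit of the forward images alone may come from a
noninvertible map. -/
theorem isClosedEmbedding_imageSeq [StandardBorelSpace X] [NullSingletonClass μ]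
    (hA : IsDenseSeparating μ A) : Topology.IsClosedEmbedding (imageSeq (μ := μ) hA.measurableSet) := by
  have hcont := continuous_imageSeq (μ := μ) hA.measurableSet
  refine ⟨⟨Topology.isInducing_iff_nhds.2 fun T => le_antisymm ?_ ?_, injective_imageSeq hA⟩, ?_⟩
  · exact map_le_iff_le_comap.1 (hcont.tendsto T)
  · exact tendsto_id'.1 (tendsto_of_tendsto_imageSeq hA tendsto_comap)
  · refine isClosed_of_closure_subset fun x hx => ?_
    obtain ⟨u, hu, hux⟩ := mem_closure_iff_seq_limit.1 hx
    choose S hS using hu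
    obtain rfl : (fun k => imageSeq hA.measurableSet (S k)) = u := funext hS
    have hm : ∀ f : Lp ℝ 1 μ, MeasurableSet {x | 1 / 2 ≤ f x} := fun f =>
      measurableSet_le measurable_const (Lp.stronglyMeasurable f).measurable
    have h1 : ∀ i, Tendsto (fun k => μ.real
        ({y | 1 / 2 ≤ (x i).1 y} ∆ (S k).image (A i))) atTop (𝓝 0) := by
      intro i
      have h := tendsto_iff_dist_tendsto_zero.1
        (((continuous_fst.comp (continuous_apply i)).tendsto _).comp hux)
      refine squeeze_zero (fun _ => measureReal_nonneg)
        (fun k => measureReal_symmDiff_le_dist (measurableSet_image (S k) (hA.measurableSet i)) _)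
        (mul_zero (2 : ℝ) ▸ h.const_mul 2)
    have h2 : ∀ i, Tendsto (fun k => μ.real
        ({y | 1 / 2 ≤ (x i).2 y} ∆ (S k)⁻¹.image (A i))) atTop (𝓝 0) := by
      intro i
      have h := tendsto_iff_dist_tendsto_zero.1
        (((continuous_snd.comp (continuous_apply i)).tendsto _).comp hux)
      refine squeeze_zero (fun _ => measureReal_nonneg)
        (fun k => measureReal_symmDiff_le_dist (measurableSet_image (S k)⁻¹ (hA.measurableSet i)) _)
        (mul_zero (2 : ℝ) ▸ h.const_mul 2)
    obtain ⟨T, hT⟩ := exists_tendsto_aut hA (fun i => hm _) (fun i => hm _) h1 h2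
    exact ⟨T, tendsto_nhds_unique ((hcont.tendsto T).comp hT) hux⟩

/-- `Aut μ` is completely metrizable, hence a Baire space. -/
theorem baireSpace [StandardBorelSpace X] [NullSingletonClass μ] : BaireSpace (Aut μ) := by
  obtain ⟨A, hA⟩ := exists_isDenseSeparating μ
  have : TopologicalSpace.IsCompletelyMetrizableSpace (Aut μ) :=
    (isClosedEmbedding_imageSeq hA).IsCompletelyMetrizableSpace
  infer_instance

end Aut

end Whirly

/-! ### Equidistribution along a column of independent samples. -/

namespace Whirly

variable {X : Type*} [MeasurableSpace X] {μ : Measure X} [IsProbabilityMeasure μ]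

section Columns

variable {K : Type*} [Fintype K]

/-- A weak law of large numbers for a sum in which each independent sample is used at most `L`
times. -/
theorem integral_sum_sq_le {g : K → X → ℝ} (hg : ∀ k, Measurable (g k))
    (hg1 : ∀ k x, |g k x| ≤ 1) (hg0 : ∀ k, ∫ x, g k x ∂μ = 0) {b : K → ℕ} {L : ℕ}
    (hb : ∀ k, (Finset.univ.filter fun k' => b k' = b k).card ≤ L) :
    ∫ x : ℕ → X, (∑ k, g k (x (b k))) ^ 2 ∂(Measure.infinitePi fun _ => μ) ≤
      Fintype.card K * L := by
  set P := Measure.infinitePi fun _ : ℕ => μ with hP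
  have hm : ∀ k, Measurable fun x : ℕ → X => g k (x (b k)) := fun k =>
    (hg k).comp (measurable_pi_apply _)
  have hprod : ∀ k k' (x : ℕ → X), |g k (x (b k)) * g k' (x (b k'))| ≤ 1 := fun k k' x => by
    rw [abs_mul]
    exact mul_le_one₀ (hg1 _ _) (abs_nonneg _) (hg1 _ _)
  have hint : ∀ k k', Integrable (fun x : ℕ → X => g k (x (b k)) * g k' (x (b k'))) P :=
    fun k k' => (integrable_const (1 : ℝ)).mono' ((hm k).mul (hm k')).aestronglyMeasurable
      (Eventually.of_forall (hprod k k'))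
  have hmean : ∀ k, ∫ x : ℕ → X, g k (x (b k)) ∂P = 0 := fun k => by
    have hmp := measurePreserving_eval_infinitePi (fun _ : ℕ => μ) (b k)
    have := integral_map (μ := P) hmp.measurable.aemeasurable
      (f := g k) (hg k).aestronglyMeasurable
    rw [hmp.map_eq, hg0] at this
    exact this.symm
  -- Distinct coordinates are independent and centred, so only pairs using the same sample
  -- contribute, at most `L` for each `k`.
  have hterm : ∀ k k', ∫ x : ℕ → X, g k (x (b k)) * g k' (x (b k')) ∂P ≤
      if b k' = b k then 1 else 0 := by
    intro k k'
    split_ifs with h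
    · calc _ ≤ ∫ _ : ℕ → X, (1 : ℝ) ∂P := integral_mono (hint k k') (integrable_const _)
            fun x => (le_abs_self _).trans (hprod k k' x)
        _ = 1 := by simp
    · have hind : ProbabilityTheory.iIndepFun (fun i (x : ℕ → X) => x i) P :=
        ProbabilityTheory.iIndepFun_infinitePi (X := fun _ x => x) fun _ => measurable_id
      have h2 := (hind.indepFun (Ne.symm h)).comp (hg k) (hg k')
      have h3 := h2.integral_mul_eq_mul_integral (hm k).aestronglyMeasurable
        (hm k').aestronglyMeasurable
      refine le_of_eq (Eq.trans h3 ?_)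
      have h4 := hmean k
      change (∫ x : ℕ → X, g k (x (b k)) ∂P) * _ = 0
      rw [h4, zero_mul]
  calc ∫ x : ℕ → X, (∑ k, g k (x (b k))) ^ 2 ∂P
      = ∑ k, ∑ k', ∫ x : ℕ → X, g k (x (b k)) * g k' (x (b k')) ∂P := by
        simp only [sq, Finset.sum_mul_sum]
        rw [integral_finsetSum _ fun k _ => integrable_finsetSum _ fun k' _ => hint k k']
        exact Finset.sum_congr rfl fun k _ => integral_finsetSum _ fun k' _ => hint k k'
    _ ≤ ∑ k : K, ∑ k' : K, if b k' = b k then (1 : ℝ) else 0 :=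
        Finset.sum_le_sum fun k _ => Finset.sum_le_sum fun k' _ => hterm k k'
    _ ≤ ∑ _k : K, (L : ℝ) := Finset.sum_le_sum fun k _ => by
        rw [Finset.sum_boole]
        exact_mod_cast hb k
    _ = Fintype.card K * L := by simp

/-- If `H` varies by at most `1 / 2`, then so do its means for two weights. -/
theorem sum_mul_sub_sum_mul_le {a b H : K → ℝ} (ha : ∀ k, 0 ≤ a k ∧ a k ≤ 1)
    (hb : ∀ k, 0 ≤ b k ∧ b k ≤ 1) (hH : ∀ k, 0 ≤ H k ∧ H k ≤ 1)
    (hvar : ∀ k k', H k' ≤ H k + 1 / 2) {p p' : ℝ} (hp : 0 ≤ p ∧ p ≤ 1) {δ : ℝ} (hδ : 0 < δ)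
    (hK : 0 < Fintype.card K) :
    p * Fintype.card K * ∑ k, b k * H k - p' * Fintype.card K * ∑ k, a k * H k ≤
      1 / 2 * p * p' * (Fintype.card K) ^ 2 + 3 * δ * (Fintype.card K) ^ 2 +
        3 / (2 * δ) * ((∑ k, (a k - p)) ^ 2 + (∑ k, (b k - p')) ^ 2) := by
  set q : ℝ := (Fintype.card K : ℝ) with hq
  have hq0 : 0 < q := hq ▸ Nat.cast_pos.2 hK
  have hcard : ∀ F : K → ℝ, (∀ k, 0 ≤ F k ∧ F k ≤ 1) → 0 ≤ ∑ k, F k ∧ ∑ k, F k ≤ q := by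
    intro F hF
    refine ⟨Finset.sum_nonneg fun k _ => (hF k).1, ?_⟩
    have := Finset.sum_le_sum fun k (_ : k ∈ Finset.univ) => (hF k).2
    simpa [hq] using this
  obtain ⟨tA, htA⟩ : ∃ t, t = ∑ k, (a k - p) := ⟨_, rfl⟩
  obtain ⟨tB, htB⟩ : ∃ t, t = ∑ k, (b k - p') := ⟨_, rfl⟩
  rw [← htA, ← htB]
  rw [Finset.sum_sub_distrib, Finset.sum_const, Finset.card_univ, nsmul_eq_mul, ← hq] at htA htB
  obtain ⟨hA0, hA1⟩ := hcard a ha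
  obtain ⟨hB0, hB1⟩ := hcard b hb
  obtain ⟨hS0, hS1⟩ := hcard (fun k => b k * H k) fun k =>
    ⟨mul_nonneg (hb k).1 (hH k).1, mul_le_one₀ (hb k).2 (hH k).1 (hH k).2⟩
  obtain ⟨hR0, hR1⟩ := hcard (fun k => a k * H k) fun k =>
    ⟨mul_nonneg (ha k).1 (hH k).1, mul_le_one₀ (ha k).2 (hH k).1 (hH k).2⟩
  -- This is the bound with the exact totals: sum `H k' - H k ≤ 1 / 2` against the weights `a k * b
  -- k'`. What remains is to replace the totals by `p q` and `p' q`.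
  have hmain : (∑ k, a k) * (∑ k, b k * H k) - (∑ k, b k) * (∑ k, a k * H k) ≤
      1 / 2 * (∑ k, a k) * (∑ k, b k) := by
    have h1 : (∑ k, b k) * (∑ k, a k * H k) = ∑ k, ∑ k', a k * (b k' * H k) := by
      rw [mul_comm, Finset.sum_mul_sum]
      exact Finset.sum_congr rfl fun k _ => Finset.sum_congr rfl fun k' _ => by ring
    rw [h1, mul_assoc, Finset.sum_mul_sum, Finset.sum_mul_sum, ← Finset.sum_sub_distrib,
      Finset.mul_sum]
    refine Finset.sum_le_sum fun k _ => ?_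
    rw [← Finset.sum_sub_distrib, Finset.mul_sum]
    refine Finset.sum_le_sum fun k' _ => ?_
    have h2 : 0 ≤ a k * b k' := mul_nonneg (ha k).1 (hb k').1
    have h3 := mul_le_mul_of_nonneg_left (hvar k k') h2
    linarith
  -- Deviations are turned into squares because only their second moments will be controlled after
  -- integration.
  have habs : ∀ t : ℝ, |t| * q ≤ δ * q ^ 2 + t ^ 2 / δ := by
    intro t
    have h1 : |t| * q ≤ δ * q ^ 2 + |t| ^ 2 / δ := by
      have h2 : |t| ^ 2 / δ = δ * (|t| / δ) ^ 2 := by field_simp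
      have h3 : |t| = δ * (|t| / δ) := by field_simp
      rw [h2]
      conv_lhs => rw [h3]
      have h4 : 0 ≤ |t| / δ := by positivity
      nlinarith [mul_nonneg hδ.le (sq_nonneg (q - |t| / δ)), mul_nonneg hδ.le (mul_nonneg h4 hq0.le)]
    rwa [sq_abs] at h1
  have hA := habs tA
  have hB := habs tB
  generalize (∑ k, a k) = A at *
  generalize (∑ k, b k) = B at *
  generalize (∑ k, b k * H k) = S at *
  generalize (∑ k, a k * H k) = R at *
  have e1 : -tA * S ≤ |tA| * q := (mul_le_mul_of_nonneg_right (neg_le_abs tA) hS0).trans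
    (mul_le_mul_of_nonneg_left hS1 (abs_nonneg _))
  have e2 : tB * R ≤ |tB| * q := (mul_le_mul_of_nonneg_right (le_abs_self tB) hR0).trans
    (mul_le_mul_of_nonneg_left hR1 (abs_nonneg _))
  have e3 : tA * B ≤ |tA| * q := (mul_le_mul_of_nonneg_right (le_abs_self tA) hB0).trans
    (mul_le_mul_of_nonneg_left hB1 (abs_nonneg _))
  have e4 : p * q * tB ≤ |tB| * q := by
    have h1 : p * q * tB ≤ p * q * |tB| :=
      mul_le_mul_of_nonneg_left (le_abs_self tB) (mul_nonneg hp.1 hq0.le)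
    have h2 : p * (q * |tB|) ≤ 1 * (q * |tB|) :=
      mul_le_mul_of_nonneg_right hp.2 (mul_nonneg hq0.le (abs_nonneg _))
    linarith
  have hAe : A = tA + p * q := by rw [htA]; ring
  have hBe : B = tB + p' * q := by rw [htB]; ring
  have e5 : p * q * S - p' * q * R ≤ 1 / 2 * p * p' * q ^ 2 + 3 / 2 * (|tA| * q + |tB| * q) := by
    have h1 : p * q * S = A * S - tA * S := by rw [hAe]; ring
    have h2 : p' * q * R = B * R - tB * R := by rw [hBe]; ring
    have h3 : 1 / 2 * A * B = 1 / 2 * (tA * B) + 1 / 2 * (p * q * tB) + 1 / 2 * p * p' * q ^ 2 := by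
      conv_lhs => rw [hAe]
      rw [add_comm, mul_add, add_mul]
      conv_lhs => rw [hBe]
      rw [hBe]
      ring
    linarith
  have e6 : 3 / (2 * δ) * (tA ^ 2 + tB ^ 2) = 3 / 2 * (tA ^ 2 / δ + tB ^ 2 / δ) := by
    field_simp
  rw [e6]
  linarith

end Columns

end Whirly

/-! ### The integrated column estimate, and transformations modelled on a finite permutation. -/

namespace Whirly

variable {X : Type*} [MeasurableSpace X] {μ : Measure X} [IsProbabilityMeasure μ]

theorem integral_sum_indicator_sub_sq_le {K : Type*} [Fintype K] {g : K → X → X}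
    (hg : ∀ k, MeasurePreserving (g k) μ μ) {b : K → ℕ} {L : ℕ}
    (hb : ∀ k, (Finset.univ.filter fun k' => b k' = b k).card ≤ L) {P : Set X}
    (hP : MeasurableSet P) :
    ∫ x : ℕ → X, (∑ k, (P.indicator (fun _ => (1 : ℝ)) (g k (x (b k))) - μ.real P)) ^ 2
      ∂(Measure.infinitePi fun _ => μ) ≤ Fintype.card K * L := by
  have hPm : Measurable (P.indicator fun _ => (1 : ℝ)) := measurable_const.indicator hP
  refine integral_sum_sq_le (g := fun k x => P.indicator (fun _ => (1 : ℝ)) (g k x) - μ.real P)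
    (fun k => (hPm.comp (hg k).measurable).sub_const _) (fun k x => ?_) (fun k => ?_) hb
  · have h1 : μ.real P ≤ 1 := measureReal_le_one
    have h0 : 0 ≤ μ.real P := measureReal_nonneg
    rw [abs_le]
    by_cases hx : g k x ∈ P
    · rw [indicator_of_mem hx]
      constructor <;> linarith
    · rw [indicator_of_notMem hx]
      constructor <;> linarith
  · have hint : Integrable (P.indicator fun _ => (1 : ℝ)) μ := (integrable_const _).indicator hP
    have hint' : Integrable (fun x => P.indicator (fun _ => (1 : ℝ)) (g k x)) μ :=
      (hg k).integrable_comp_of_integrable hint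
    rw [integral_sub hint' (integrable_const _)]
    have h1 : ∫ x, P.indicator (fun _ => (1 : ℝ)) (g k x) ∂μ = μ.real P := by
      have h2 := integral_map (hg k).measurable.aemeasurable (μ := μ)
        (f := P.indicator fun _ => (1 : ℝ)) hPm.aestronglyMeasurable
      rw [(hg k).map_eq, integral_indicator_const _ hP] at h2
      simpa using h2.symm
    rw [h1]
    simp

/-- In a column whose orbits are equidistributed, a function that varies by at most `1 / 2` along
the orbits cannot separate two sets. -/
theorem column_integral_le {K : Type*} [Fintype K] [Nonempty K] {g : K → X → X}
    (hg : ∀ k, MeasurePreserving (g k) μ μ) {b : K → ℕ} {L : ℕ}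
    (hb : ∀ k, (Finset.univ.filter fun k' => b k' = b k).card ≤ L) {P Q : Set X}
    (hP : MeasurableSet P) (hQ : MeasurableSet Q) {H : K → (ℕ → X) → ℝ}
    (hint : ∀ k, Integrable (H k) (Measure.infinitePi fun _ => μ))
    (hH : ∀ k, ∀ᵐ x ∂(Measure.infinitePi fun _ => μ), 0 ≤ H k x ∧ H k x ≤ 1)
    (hvar : ∀ k k', ∀ᵐ x ∂(Measure.infinitePi fun _ => μ), H k' x ≤ H k x + 1 / 2)
    {δ : ℝ} (hδ : 0 < δ) :
    μ.real P * Fintype.card K * ∑ k, ∫ x in {x | g k (x (b k)) ∈ Q}, H k x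
        ∂(Measure.infinitePi fun _ => μ) -
      μ.real Q * Fintype.card K * ∑ k, ∫ x in {x | g k (x (b k)) ∈ P}, H k x
        ∂(Measure.infinitePi fun _ => μ) ≤
      1 / 2 * μ.real P * μ.real Q * (Fintype.card K) ^ 2 + 3 * δ * (Fintype.card K) ^ 2 +
        3 / (2 * δ) * (Fintype.card K * L + Fintype.card K * L) := by
  set Pr := Measure.infinitePi fun _ : ℕ => μ with hPr
  let a : Set X → K → (ℕ → X) → ℝ := fun E k x => E.indicator (fun _ => (1 : ℝ)) (g k (x (b k)))
  have hgm : ∀ k, Measurable fun x : ℕ → X => g k (x (b k)) := fun k =>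
    (hg k).measurable.comp (measurable_pi_apply _)
  have ham : ∀ E, MeasurableSet E → ∀ k, Measurable (a E k) := fun E hE k =>
    (measurable_const.indicator hE).comp (hgm k)
  have ha01 : ∀ E k x, 0 ≤ a E k x ∧ a E k x ≤ 1 := by
    intro E k x
    by_cases hx : g k (x (b k)) ∈ E <;> simp [a, hx]
  have hmul : ∀ E k, (fun x => a E k x * H k x) =
      {x | g k (x (b k)) ∈ E}.indicator (H k) := by
    intro E k
    funext x
    by_cases hx : g k (x (b k)) ∈ E <;> simp [a, hx]
  have hset : ∀ E, MeasurableSet E → ∀ k, MeasurableSet {x : ℕ → X | g k (x (b k)) ∈ E} :=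
    fun E hE k => hgm k hE
  have hI : ∀ E, MeasurableSet E → ∀ k, ∫ x in {x | g k (x (b k)) ∈ E}, H k x ∂Pr =
      ∫ x, a E k x * H k x ∂Pr := by
    intro E hE k
    rw [hmul, integral_indicator (hset E hE k)]
  have hintm : ∀ E, MeasurableSet E → ∀ k, Integrable (fun x => a E k x * H k x) Pr := by
    intro E hE k
    rw [hmul]
    exact (hint k).indicator (hset E hE k)
  have hsq : ∀ E, MeasurableSet E → Integrable (fun x => (∑ k, (a E k x - μ.real E)) ^ 2) Pr := by
    intro E hE
    refine (integrable_const ((Fintype.card K : ℝ) ^ 2)).mono'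
      ((Finset.measurable_sum _ fun k _ => (ham E hE k).sub_const _).pow_const 2).aestronglyMeasurable
      (Eventually.of_forall fun x => ?_)
    rw [Real.norm_eq_abs, abs_pow]
    refine pow_le_pow_left₀ (abs_nonneg _) ?_ 2
    refine (Finset.abs_sum_le_sum_abs _ _).trans ?_
    have : ∀ k ∈ Finset.univ, |a E k x - μ.real E| ≤ 1 := by
      intro k _
      have h1 : μ.real E ≤ 1 := measureReal_le_one
      have h0 : 0 ≤ μ.real E := measureReal_nonneg
      have h2 := ha01 E k x
      rw [abs_le]
      constructor <;> linarith
    simpa using Finset.sum_le_sum this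
  have hpt : ∀ᵐ x ∂Pr, μ.real P * Fintype.card K * ∑ k, a Q k x * H k x -
      μ.real Q * Fintype.card K * ∑ k, a P k x * H k x ≤
      1 / 2 * μ.real P * μ.real Q * (Fintype.card K) ^ 2 + 3 * δ * (Fintype.card K) ^ 2 +
        3 / (2 * δ) * ((∑ k, (a P k x - μ.real P)) ^ 2 + (∑ k, (a Q k x - μ.real Q)) ^ 2) := by
    filter_upwards [ae_all_iff.2 hH, ae_all_iff.2 fun k => ae_all_iff.2 (hvar k)] with x h1 h2
    exact sum_mul_sub_sum_mul_le (a := fun k => a P k x) (b := fun k => a Q k x)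
      (fun k => ha01 P k x) (fun k => ha01 Q k x) h1 h2 ⟨measureReal_nonneg, measureReal_le_one⟩ hδ
      Fintype.card_pos
  have hlhs : ∀ E, MeasurableSet E → ∀ c : ℝ,
      Integrable (fun x => c * ∑ k, a E k x * H k x) Pr := fun E hE c =>
    (integrable_finsetSum _ fun k _ => hintm E hE k).const_mul c
  have hmono := integral_mono_ae ((hlhs Q hQ _).sub (hlhs P hP _))
    ((integrable_const _).add (((hsq P hP).add (hsq Q hQ)).const_mul _)) hpt
  have e1 : ∫ x, (μ.real P * Fintype.card K * ∑ k, a Q k x * H k x -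
      μ.real Q * Fintype.card K * ∑ k, a P k x * H k x) ∂Pr =
      μ.real P * Fintype.card K * ∑ k, ∫ x in {x | g k (x (b k)) ∈ Q}, H k x ∂Pr -
      μ.real Q * Fintype.card K * ∑ k, ∫ x in {x | g k (x (b k)) ∈ P}, H k x ∂Pr := by
    rw [integral_sub (hlhs Q hQ _) (hlhs P hP _), integral_const_mul, integral_const_mul,
      integral_finsetSum _ fun k _ => hintm Q hQ k, integral_finsetSum _ fun k _ => hintm P hP k]
    simp only [hI Q hQ, hI P hP]
  have e2 : ∫ x, (1 / 2 * μ.real P * μ.real Q * (Fintype.card K) ^ 2 +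
        3 * δ * (Fintype.card K) ^ 2 +
        3 / (2 * δ) * ((∑ k, (a P k x - μ.real P)) ^ 2 + (∑ k, (a Q k x - μ.real Q)) ^ 2)) ∂Pr =
      1 / 2 * μ.real P * μ.real Q * (Fintype.card K) ^ 2 + 3 * δ * (Fintype.card K) ^ 2 +
        3 / (2 * δ) * (∫ x, (∑ k, (a P k x - μ.real P)) ^ 2 ∂Pr +
          ∫ x, (∑ k, (a Q k x - μ.real Q)) ^ 2 ∂Pr) := by
    have hs : Integrable (fun x => 3 / (2 * δ) * ((∑ k, (a P k x - μ.real P)) ^ 2 +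
        (∑ k, (a Q k x - μ.real Q)) ^ 2)) Pr := ((hsq P hP).add (hsq Q hQ)).const_mul _
    rw [integral_add (integrable_const _) hs,
      integral_const_mul, integral_add (hsq P hP) (hsq Q hQ)]
    simp
  have h3 := integral_sum_indicator_sub_sq_le hg hb hP
  have h4 := integral_sum_indicator_sub_sq_le hg hb hQ
  rw [← e1]
  refine le_trans hmono (le_of_eq_of_le e2 ?_)
  gcongr

instance nullSingletonClass_infinitePi [NullSingletonClass μ] [MeasurableSingletonClass X] :
    NullSingletonClass (Measure.infinitePi fun _ : ℕ => μ) where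
  measure_singleton x := by
    refine measure_mono_null (t := Function.eval 0 ⁻¹' {x 0}) (by rintro _ rfl; rfl) ?_
    rw [(measurePreserving_eval_infinitePi (fun _ : ℕ => μ) 0).measure_preimage
      (measurableSet_singleton _).nullMeasurableSet]
    exact measure_singleton _

/-- A transformation of `X` that is modelled on a permutation of a finite set, such that finitely
many sets are labelled along powers of a given transformation applied to independent samples. -/
theorem exists_modelled_transformation [StandardBorelSpace X] [NullSingletonClass μ]
    {D : Type*} [Finite D] [MeasurableSpace D] [DiscreteMeasurableSpace D] (κ : Measure D)
    [IsProbabilityMeasure κ] (σ : Equiv.Perm D) (hσ : MeasurePreserving σ κ κ) {g : D → X → X}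
    (hg : ∀ d, MeasurePreserving (g d) μ μ) (b : D → ℕ) {ι : Type*} [Finite ι] {G : ι → Set X}
    (hG : ∀ i, MeasurableSet (G i)) :
    ∃ (f : mpGroup μ) (θ : D × (ℕ → X) ≃ᵐ X),
      MeasurePreserving θ (κ.prod (Measure.infinitePi fun _ => μ)) μ ∧
      (∀ y, (f : Equiv.Perm X) (θ y) = θ (σ y.1, y.2)) ∧
      ∀ i, ∀ᵐ y ∂κ.prod (Measure.infinitePi fun _ => μ),
        θ y ∈ G i ↔ g y.1 (y.2 (b y.1)) ∈ G i := by
  set Pr := Measure.infinitePi fun _ : ℕ => μ with hPr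
  let ψ : D × (ℕ → X) → X := fun y => g y.1 (y.2 (b y.1))
  have hψm : ∀ d, MeasurePreserving (fun x : ℕ → X => g d (x (b d))) Pr μ := fun d =>
    (hg d).comp (measurePreserving_eval_infinitePi (fun _ : ℕ => μ) (b d))
  have hψ : MeasurePreserving ψ (κ.prod Pr) μ := by
    have hm : Measurable ψ := measurable_from_prod_countable_right fun d => (hψm d).measurable
    refine ⟨hm, Measure.ext fun E hE => ?_⟩
    rw [Measure.map_apply hm hE, Measure.prod_apply (hm hE)]
    have : ∀ d, Pr (Prod.mk d ⁻¹' (ψ ⁻¹' E)) = μ E := fun d =>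
      (hψm d).measure_preimage hE.nullMeasurableSet
    simp [this]
  let l : X → ι → Prop := fun x i => x ∈ G i
  have hl : Measurable l := measurable_pi_iff.2 fun i => measurable_mem.2 (hG i)
  -- In general `ψ` is not injective; `θ` need only agree with it on the labels, which record
  -- membership in the sets `G i`.
  obtain ⟨θ, hθ, hlab⟩ := exists_measurableEquiv_label hψ hl
  have hS : MeasurePreserving (Prod.map σ id : D × (ℕ → X) → D × (ℕ → X)) (κ.prod Pr)
      (κ.prod Pr) := hσ.prod (MeasurePreserving.id Pr)
  let eσ : D ≃ᵐ D := ⟨σ, measurable_of_countable _, measurable_of_countable _⟩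
  have hS' : MeasurePreserving (Prod.map σ.symm id : D × (ℕ → X) → D × (ℕ → X)) (κ.prod Pr)
      (κ.prod Pr) := (MeasurePreserving.symm eσ hσ).prod (MeasurePreserving.id Pr)
  have hθ' := hθ.symm θ
  let f : Equiv.Perm X := θ.symm.toEquiv.trans ((Equiv.prodCongr σ (Equiv.refl _)).trans θ.toEquiv)
  have hf : MeasurePreserving f μ μ := (hθ.comp hS).comp hθ'
  have hf' : MeasurePreserving f.symm μ μ := (hθ.comp hS').comp hθ'
  refine ⟨⟨f, hf, hf'⟩, θ, hθ, fun y => ?_, fun i => ?_⟩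
  · change θ (Prod.map σ id (θ.symm (θ y))) = θ (σ y.1, y.2)
    rw [MeasurableEquiv.symm_apply_apply]
    rfl
  · filter_upwards [hlab] with y hy
    exact iff_of_eq (congrFun hy i)

end Whirly

/-! ### Products with a weighted finite set, and the behaviour of the modelled transformation. -/

namespace Whirly

section FiniteWeights

variable {D : Type*} [Fintype D] [MeasurableSpace D] [DiscreteMeasurableSpace D]

/-- The measure on a finite set with given weights. -/
noncomputable def weightMeasure (w : D → ℝ) : Measure D :=
  ∑ d, ENNReal.ofReal (w d) • Measure.dirac d

theorem weightMeasure_singleton (w : D → ℝ) (d : D) :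
    weightMeasure w {d} = ENNReal.ofReal (w d) := by
  classical
  rw [weightMeasure, Measure.finsetSum_apply, Finset.sum_eq_single d]
  · simp
  · intro e _ he
    simp [he]
  · simp

theorem weightMeasure_real_singleton {w : D → ℝ} (hw : ∀ d, 0 ≤ w d) (d : D) :
    (weightMeasure w).real {d} = w d := by
  rw [Measure.real, weightMeasure_singleton, ENNReal.toReal_ofReal (hw d)]

theorem isProbabilityMeasure_weightMeasure {w : D → ℝ} (hw : ∀ d, 0 ≤ w d) (h1 : ∑ d, w d = 1) :
    IsProbabilityMeasure (weightMeasure w) := by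
  refine ⟨?_⟩
  rw [weightMeasure, Measure.finsetSum_apply]
  simp only [Measure.smul_apply, measure_univ, smul_eq_mul, mul_one]
  rw [← ENNReal.ofReal_sum_of_nonneg fun d _ => hw d, h1, ENNReal.ofReal_one]

theorem measurePreserving_weightMeasure {w : D → ℝ} {σ : Equiv.Perm D}
    (h : ∀ d, w (σ d) = w d) : MeasurePreserving σ (weightMeasure w) (weightMeasure w) := by
  refine ⟨measurable_of_countable _, Measure.ext_of_singleton fun d => ?_⟩
  rw [Measure.map_apply (measurable_of_countable _) (measurableSet_singleton d)]
  have : σ ⁻¹' {d} = {σ.symm d} := by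
    ext e
    simp [Equiv.eq_symm_apply]
  rw [this, weightMeasure_singleton, weightMeasure_singleton, ← h (σ.symm d),
    Equiv.apply_symm_apply]

variable {Ω : Type*} [MeasurableSpace Ω] {κ : Measure D} {Pr : Measure Ω} [IsProbabilityMeasure κ]
  [IsProbabilityMeasure Pr]

theorem ae_fibre_of_ae_prod (hκ : ∀ d, 0 < κ.real {d}) {p : D × Ω → Prop}
    (h : ∀ᵐ y ∂κ.prod Pr, p y) : ∀ᵐ x ∂Pr, ∀ d, p (d, x) := by
  rw [ae_all_iff]
  intro d
  by_contra hd
  have h1 := Measure.ae_ae_of_ae_prod h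
  rw [ae_iff] at h1
  have h2 : κ {d} ≤ 0 := h1 ▸ measure_mono (singleton_subset_iff.2 hd)
  exact (measureReal_pos_iff_measure_pos.1 (hκ d)).not_ge h2

theorem ae_prod_of_ae_fibre {p : D × Ω → Prop} (h : ∀ᵐ x ∂Pr, ∀ d, p (d, x)) :
    ∀ᵐ y ∂κ.prod Pr, p y := by
  filter_upwards [Measure.quasiMeasurePreserving_snd.ae h] with y hy using hy y.1

theorem measureReal_le_of_ae_fst {Z : Set (D × Ω)} {B : Set D}
    (h : ∀ᵐ y ∂κ.prod Pr, y ∈ Z → y.1 ∈ B) : (κ.prod Pr).real Z ≤ κ.real B := by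
  have h1 : (κ.prod Pr).real (B ×ˢ univ) = κ.real B := by
    rw [measureReal_prod_prod]
    simp
  rw [← h1]
  refine ENNReal.toReal_mono (measure_ne_top _ _) (measure_mono_ae ?_)
  filter_upwards [h] with y hy hyZ using ⟨hy hyZ, mem_univ _⟩

theorem setIntegral_prod_fintype {F : D × Ω → ℝ} (hF : Integrable F (κ.prod Pr)) {E : Set (D × Ω)}
    (hE : MeasurableSet E) :
    ∫ y in E, F y ∂κ.prod Pr = ∑ d, κ.real {d} * ∫ x in {x | (d, x) ∈ E}, F (d, x) ∂Pr := by
  rw [← integral_indicator hE, integral_prod _ (hF.indicator hE),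
    integral_fintype Integrable.of_finite]
  refine Finset.sum_congr rfl fun d _ => ?_
  have hEd : MeasurableSet {x | (d, x) ∈ E} := measurable_prodMk_left hE
  rw [smul_eq_mul, ← integral_indicator hEd]
  rfl

end FiniteWeights

variable {X : Type*} [MeasurableSpace X] {μ : Measure X} [IsProbabilityMeasure μ]
  {D : Type*} [Fintype D] [MeasurableSpace D] [DiscreteMeasurableSpace D] {κ : Measure D}
  [IsProbabilityMeasure κ] {σ : Equiv.Perm D} {f : mpGroup μ}

theorem measureReal_preimage_equiv {Y : Type*} [MeasurableSpace Y] {ν : Measure Y} {θ : Y ≃ᵐ X}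
    (hθ : MeasurePreserving θ ν μ) (Z : Set X) : ν.real (θ ⁻¹' Z) = μ.real Z := by
  rw [Measure.real, hθ.measure_preimage_equiv, Measure.real]

section Model

variable {Ω : Type*} [MeasurableSpace Ω] {Pr : Measure Ω} [IsProbabilityMeasure Pr]
  {θ : D × Ω ≃ᵐ X}

theorem model_pow (hf : ∀ y, (f : Equiv.Perm X) (θ y) = θ (σ y.1, y.2)) (n : ℕ) (y : D × Ω) :
    ((f ^ n : mpGroup μ) : Equiv.Perm X) (θ y) = θ ((σ ^ n) y.1, y.2) := by
  induction n with
  | zero => simp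
  | succ n ih =>
    rw [pow_succ', pow_succ']
    change (f : Equiv.Perm X) (((f ^ n : mpGroup μ) : Equiv.Perm X) (θ y)) = _
    rw [ih, hf]
    rfl

/-- The power of `f` fixes every point lying over an index fixed by the same power of `σ`. -/
theorem model_pow_mem_basicNhd (hθ : MeasurePreserving θ (κ.prod Pr) μ)
    (hf : ∀ y, (f : Equiv.Perm X) (θ y) = θ (σ y.1, y.2)) {A : ℕ → Set X} {k n : ℕ}
    (h : κ.real {d | (σ ^ n) d ≠ d} < 1 / ((k : ℝ) + 1)) :
    Aut.mk μ (f ^ n) ∈ Aut.basicNhd μ A k := by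
  refine Aut.mk_mem_basicNhd _ (lt_of_le_of_lt ?_ h)
  rw [← measureReal_preimage_equiv hθ]
  refine measureReal_le_of_ae_fst (Eventually.of_forall fun y hy heq => hy ?_)
  rw [model_pow hf, heq]

end Model

/-- When `σ d` is outside `B`, passing from `d` to `σ d` keeps the sample and applies `f₀` once
more, so `f` acts on labels as `f₀` does. Both `E` and its image under `f₀` must be labelled to
express this. -/
theorem model_measureReal_symmDiff_le {θ : D × (ℕ → X) ≃ᵐ X}
    (hθ : MeasurePreserving θ (κ.prod (Measure.infinitePi fun _ => μ)) μ)
    (hf : ∀ y, (f : Equiv.Perm X) (θ y) = θ (σ y.1, y.2)) (hκ : ∀ d, 0 < κ.real {d})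
    {f₀ : mpGroup μ} {b c : D → ℕ} {B : Set D}
    (hB : ∀ d, σ d ∉ B → b (σ d) = b d ∧ c (σ d) = c d + 1) {E : Set X}
    (hE : ∀ᵐ y ∂κ.prod (Measure.infinitePi fun _ => μ), θ y ∈ E ↔
      ((f₀ ^ c y.1 : mpGroup μ) : Equiv.Perm X) (y.2 (b y.1)) ∈ E)
    (hE' : ∀ᵐ y ∂κ.prod (Measure.infinitePi fun _ => μ), θ y ∈ (f₀ : Equiv.Perm X) '' E ↔
      ((f₀ ^ c y.1 : mpGroup μ) : Equiv.Perm X) (y.2 (b y.1)) ∈ (f₀ : Equiv.Perm X) '' E) :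
    μ.real (((f₀ : Equiv.Perm X) '' E) ∆ ((f : Equiv.Perm X) '' E)) ≤ κ.real B := by
  rw [← measureReal_preimage_equiv hθ]
  refine measureReal_le_of_ae_fst (ae_prod_of_ae_fibre ?_)
  filter_upwards [ae_fibre_of_ae_prod hκ hE, ae_fibre_of_ae_prod hκ hE'] with x h1 h2 e he
  by_contra heB
  obtain ⟨d, rfl⟩ := σ.surjective e
  obtain ⟨hb, hc⟩ := hB d heB
  have h3 : θ (σ d, x) ∈ (f : Equiv.Perm X) '' E ↔ θ (d, x) ∈ E := by
    rw [← hf (d, x)]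
    exact (Equiv.injective _).mem_set_image
  have h4 : θ (σ d, x) ∈ (f₀ : Equiv.Perm X) '' E ↔ θ (d, x) ∈ E := by
    rw [h2 (σ d), h1 d]
    rw [hb, hc, pow_succ']
    exact (Equiv.injective _).mem_set_image
  have he' : θ (σ d, x) ∈ ((f₀ : Equiv.Perm X) '' E) ∆ ((f : Equiv.Perm X) '' E) := he
  rw [mem_symmDiff, h3, h4] at he'
  tauto

theorem model_setIntegral {θ : D × (ℕ → X) ≃ᵐ X}
    (hθ : MeasurePreserving θ (κ.prod (Measure.infinitePi fun _ => μ)) μ)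
    (hκ : ∀ d, 0 < κ.real {d}) {g : D → X → X} {b : D → ℕ} {E : Set X} (hEm : MeasurableSet E)
    (hE : ∀ᵐ y ∂κ.prod (Measure.infinitePi fun _ => μ), θ y ∈ E ↔ g y.1 (y.2 (b y.1)) ∈ E)
    {h : X → ℝ} (hint : Integrable h μ) :
    ∫ x in E, h x ∂μ = ∑ d, κ.real {d} * ∫ x in {x : ℕ → X | g d (x (b d)) ∈ E}, h (θ (d, x))
      ∂Measure.infinitePi fun _ => μ := by
  rw [← hθ.setIntegral_preimage_emb θ.measurableEmbedding h E,
    setIntegral_prod_fintype (F := fun y => h (θ y)) (hθ.integrable_comp_of_integrable hint) (θ.measurable hEm)]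
  refine Finset.sum_congr rfl fun d _ => ?_
  congr 1
  refine setIntegral_congr_set ?_
  rw [Filter.eventuallyEq_set]
  filter_upwards [ae_fibre_of_ae_prod hκ hE] with x hx using hx d

end Whirly

/-! ### Simultaneous rotation of cycles of coprime lengths. -/

namespace Whirly

section Columns

theorem card_filter_dvd_val_le {q : ℕ} [NeZero q] (L : ℕ) :
    (Finset.univ.filter fun k : ZMod q => L ∣ k.val).card ≤ q / L + 1 := by
  refine (Finset.card_le_card_of_injOn (t := Finset.range (q / L + 1)) (fun k => k.val / L)
    (fun k _ => ?_) fun k hk k' hk' h => ?_).trans_eq (Finset.card_range _)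
  · exact Finset.mem_coe.2 (Finset.mem_range.2 (Nat.lt_succ_of_le
      (Nat.div_le_div_right (ZMod.val_lt k).le)))
  · have h1 : L ∣ k.val := (Finset.mem_filter.1 hk).2
    have h2 : L ∣ k'.val := (Finset.mem_filter.1 hk').2
    apply ZMod.val_injective q
    rw [← Nat.div_mul_cancel h1, ← Nat.div_mul_cancel h2]
    exact congrArg (· * L) h

theorem card_filter_val_div_eq_le {q : ℕ} [NeZero q] {L : ℕ} (hL : 0 < L) (k : ZMod q) :
    (Finset.univ.filter fun k' : ZMod q => k'.val / L = k.val / L).card ≤ L := by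
  refine (Finset.card_le_card_of_injOn (t := Finset.range L) (fun k => k.val % L)
    (fun k _ => Finset.mem_coe.2 (Finset.mem_range.2 (Nat.mod_lt _ hL)))
    fun k₁ h₁ k₂ h₂ h => ?_).trans_eq (Finset.card_range _)
  have h1 : k₁.val / L = k.val / L := (Finset.mem_filter.1 h₁).2
  have h2 : k₂.val / L = k.val / L := (Finset.mem_filter.1 h₂).2
  apply ZMod.val_injective q
  have h3 : k₁.val % L = k₂.val % L := h
  rw [← Nat.div_add_mod k₁.val L, ← Nat.div_add_mod k₂.val L, h1, h2, h3]

/-- Wrapping around lands on 0, which `L` divides; the exceptional set thus covers the closing of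
the cycle as well as the block ends. -/
theorem val_add_one_of_not_dvd {q : ℕ} [NeZero q] {L : ℕ} {k : ZMod q}
    (h : ¬ L ∣ (k + 1).val) : (k + 1).val / L = k.val / L ∧ (k + 1).val = k.val + 1 := by
  have h1 : (k + 1).val = k.val + 1 := by
    rcases Nat.lt_or_ge (k.val + 1) q with hlt | hge
    · rcases Nat.lt_or_ge 1 q with hq | hq
      · have : Fact (1 < q) := ⟨hq⟩
        rw [ZMod.val_add_of_lt (by rwa [ZMod.val_one]), ZMod.val_one]
      · omega
    · exfalso
      have h2 : k.val + 1 = q := le_antisymm (ZMod.val_lt k) hge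
      have h3 : k + 1 = 0 := by
        rw [← ZMod.natCast_zmod_val k]
        have := congrArg (Nat.cast : ℕ → ZMod q) h2
        simpa using this
      rw [h3, ZMod.val_zero] at h
      exact h (dvd_zero L)
  refine ⟨?_, h1⟩
  rw [h1] at h ⊢
  exact Nat.succ_div_of_not_dvd h

/-- The simultaneous rotation of finitely many cycles. -/
def rotation {r : ℕ} (q : Fin r → ℕ) : Equiv.Perm (Σ s : Fin r, ZMod (q s)) :=
  Equiv.sigmaCongrRight fun s => Equiv.addRight (1 : ZMod (q s))

variable {r : ℕ} {q : Fin r → ℕ}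

theorem rotation_pow (n : ℕ) (s : Fin r) (k : ZMod (q s)) :
    (rotation q ^ n) ⟨s, k⟩ = ⟨s, k + n⟩ := by
  induction n with
  | zero => simp
  | succ n ih =>
    rw [pow_succ', Equiv.Perm.mul_apply, ih]
    simp [rotation, add_assoc]

variable [∀ s, NeZero (q s)]

/-- If the lengths of the cycles are pairwise coprime, then some power of the rotation moves only
one cycle, by a given amount. -/
theorem exists_rotation_pow (hq : Pairwise fun s t => (q s).Coprime (q t)) (s : Fin r)
    (j : ZMod (q s)) :
    ∃ n : ℕ, (∀ k, (rotation q ^ n) ⟨s, k⟩ = ⟨s, k + j⟩) ∧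
      ∀ t, t ≠ s → ∀ k, (rotation q ^ n) ⟨t, k⟩ = ⟨t, k⟩ := by
  -- The product of the other lengths vanishes modulo each of them and is invertible modulo `q s`.
  let M := ∏ t ∈ Finset.univ.erase s, q t
  have hM : M.Coprime (q s) :=
    Nat.Coprime.prod_left fun t ht => hq (Finset.ne_of_mem_erase ht)
  have h1 : (M : ZMod (q s)) * (M : ZMod (q s))⁻¹ = 1 := ZMod.coe_mul_inv_eq_one M hM
  refine ⟨M * ((M : ZMod (q s))⁻¹ * j).val, fun k => ?_, fun t hts k => ?_⟩
  · rw [rotation_pow, Nat.cast_mul, ZMod.natCast_zmod_val, ← mul_assoc, h1, one_mul]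
  · have h2 : ((M : ℕ) : ZMod (q t)) = 0 :=
      (ZMod.natCast_eq_zero_iff _ _).2
        (Finset.dvd_prod_of_mem q (Finset.mem_erase.2 ⟨hts, Finset.mem_univ t⟩))
    rw [rotation_pow, Nat.cast_mul, h2, zero_mul, add_zero]

instance discreteMeasurableSpace_sigma_zmod :
    DiscreteMeasurableSpace (Σ s : Fin r, ZMod (q s)) where
  forall_measurableSet E := MeasurableSpace.measurableSet_iInf.2 fun s =>
    (MeasurableSet.of_discrete : MeasurableSet (Sigma.mk s ⁻¹' E))

/-- The weights that give the same mass to all cycles, equidistributed on each cycle. -/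
noncomputable def cycleWeight (q : Fin r → ℕ) (d : Σ s : Fin r, ZMod (q s)) : ℝ :=
  1 / (r * q d.1)

theorem cycleWeight_pos (d : Σ s : Fin r, ZMod (q s)) : 0 < cycleWeight q d := by
  have h1 : 0 < r := Fin.pos d.1
  have h2 : 0 < q d.1 := Nat.pos_of_ne_zero (NeZero.ne _)
  rw [cycleWeight]
  positivity

theorem measureReal_eq_sum {D : Type*} [Fintype D] [MeasurableSpace D] [DiscreteMeasurableSpace D]
    (κ : Measure D) [IsFiniteMeasure κ] (p : D → Prop) [DecidablePred p] :
    κ.real {d | p d} = ∑ d, if p d then κ.real {d} else 0 := by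
  rw [← Finset.sum_filter, sum_measureReal_singleton]
  simp

theorem cycle_sum (F : (Σ s : Fin r, ZMod (q s)) → ℝ) :
    ∑ d, cycleWeight q d * F d = ∑ s : Fin r, 1 / (r * q s) * ∑ k, F ⟨s, k⟩ := by
  rw [Fintype.sum_sigma]
  simp only [cycleWeight, Finset.mul_sum]

theorem sum_cycleWeight (hr : 0 < r) : ∑ d, cycleWeight q d = 1 := by
  have h := cycle_sum (q := q) fun _ => 1
  simp only [mul_one, Finset.sum_const, Finset.card_univ, ZMod.card, nsmul_eq_mul] at h
  rw [h]
  have h1 : ∀ s : Fin r, (1 : ℝ) / (r * q s) * q s = 1 / r := fun s => by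
    have : (q s : ℝ) ≠ 0 := Nat.cast_ne_zero.2 (NeZero.ne _)
    have : (r : ℝ) ≠ 0 := Nat.cast_ne_zero.2 hr.ne'
    field_simp
  simp only [h1, Finset.sum_const, Finset.card_univ, Fintype.card_fin, nsmul_eq_mul]
  have : (r : ℝ) ≠ 0 := Nat.cast_ne_zero.2 hr.ne'
  field_simp

theorem isProbabilityMeasure_cycle (hr : 0 < r) :
    IsProbabilityMeasure (weightMeasure (cycleWeight q)) :=
  isProbabilityMeasure_weightMeasure (fun d => (cycleWeight_pos d).le) (sum_cycleWeight hr)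

theorem measureReal_cycle_singleton (d : Σ s : Fin r, ZMod (q s)) :
    (weightMeasure (cycleWeight q)).real {d} = cycleWeight q d :=
  weightMeasure_real_singleton (fun d => (cycleWeight_pos d).le) d

theorem measureReal_cycle_eq_sum (hr : 0 < r) (p : (Σ s : Fin r, ZMod (q s)) → Prop)
    [DecidablePred p] : (weightMeasure (cycleWeight q)).real {d | p d} =
      ∑ s : Fin r, 1 / (r * q s) * ((Finset.univ.filter fun k => p ⟨s, k⟩).card : ℝ) := by
  have := isProbabilityMeasure_cycle (q := q) hr
  rw [measureReal_eq_sum]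
  simp only [measureReal_cycle_singleton]
  have := cycle_sum (q := q) fun d => if p d then (1 : ℝ) else 0
  simp only [mul_ite, mul_one, mul_zero, Finset.sum_boole] at this
  exact this

/-- A cycle of length `q` has at most `q / L + 1` block starts; the extra one accounts for the term
`1 / N`. -/
theorem measureReal_cycle_dvd_le (hr : 0 < r) {L N : ℕ} (hN : 0 < N)
    (hq : ∀ s, N ≤ q s) :
    (weightMeasure (cycleWeight q)).real {d | L ∣ d.2.val} ≤ 1 / L + 1 / N := by
  rw [measureReal_cycle_eq_sum hr]
  have hr' : (0 : ℝ) < r := Nat.cast_pos.2 hr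
  have h1 : ∀ s : Fin r, 1 / ((r : ℝ) * q s) *
      ((Finset.univ.filter fun k : ZMod (q s) => L ∣ k.val).card : ℝ) ≤
        1 / r * (1 / L + 1 / N) := by
    intro s
    have hqs : (0 : ℝ) < q s := Nat.cast_pos.2 (hN.trans_le (hq s))
    have h2 : ((Finset.univ.filter fun k : ZMod (q s) => L ∣ k.val).card : ℝ) ≤
        q s / L + 1 := by
      refine (Nat.cast_le.2 (card_filter_dvd_val_le L)).trans ?_
      push_cast
      exact add_le_add_left Nat.cast_div_le _
    have h3 : (1 : ℝ) / q s ≤ 1 / N :=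
      one_div_le_one_div_of_le (Nat.cast_pos.2 hN) (Nat.cast_le.2 (hq s))
    calc _ ≤ 1 / ((r : ℝ) * q s) * (q s / L + 1) :=
          mul_le_mul_of_nonneg_left h2 (by positivity)
      _ = 1 / r * (1 / L + 1 / q s) := by field_simp
      _ ≤ _ := by gcongr
  refine (Finset.sum_le_sum fun s _ => h1 s).trans_eq ?_
  simp only [Finset.sum_const, Finset.card_univ, Fintype.card_fin, nsmul_eq_mul]
  field_simp

theorem measureReal_cycle_column (hr : 0 < r) (s : Fin r) :
    (weightMeasure (cycleWeight q)).real {d | d.1 = s} = 1 / r := by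
  classical
  rw [measureReal_cycle_eq_sum hr, Finset.sum_eq_single s]
  · have h1 : (q s : ℝ) ≠ 0 := Nat.cast_ne_zero.2 (NeZero.ne _)
    have h2 : (r : ℝ) ≠ 0 := Nat.cast_ne_zero.2 hr.ne'
    simp [ZMod.card]
    field_simp
  · intro t _ hts
    simp [hts]
  · simp

end Columns

end Whirly

/-! ### Unobstructed transformations are dense; conclusion by Baire category. -/

namespace Whirly

variable {X : Type*} [MeasurableSpace X] {μ : Measure X} [IsProbabilityMeasure μ]

/-- A transformation modelled on many long cycles of coprime lengths is not obstructed. -/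
theorem model_notMem_obstructed {r : ℕ} (hr : 0 < r) {q : Fin r → ℕ} [∀ s, NeZero (q s)]
    (hq : Pairwise fun s t => (q s).Coprime (q t)) {L N : ℕ} (hL : 0 < L) (hN : 0 < N)
    (hqN : ∀ s, N ≤ q s) {k : ℕ} (hk : 1 / (r : ℝ) < 1 / ((k : ℝ) + 1)) {f f₀ : mpGroup μ}
    {θ : (Σ s : Fin r, ZMod (q s)) × (ℕ → X) ≃ᵐ X}
    (hθ : MeasurePreserving θ
      ((weightMeasure (cycleWeight q)).prod (Measure.infinitePi fun _ => μ)) μ)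
    (hf : ∀ y, (f : Equiv.Perm X) (θ y) = θ (rotation q y.1, y.2)) {A : ℕ → Set X}
    {P Q : Set X} (hP : MeasurableSet P) (hQ : MeasurableSet Q)
    (hlab : ∀ E ∈ ({P, Q} : Set (Set X)),
      ∀ᵐ y ∂(weightMeasure (cycleWeight q)).prod (Measure.infinitePi fun _ => μ),
        θ y ∈ E ↔ ((f₀ ^ y.1.2.val : mpGroup μ) : Equiv.Perm X) (y.2 (y.1.2.val / L)) ∈ E)
    {δ : ℝ} (hδ : 0 < δ) (hsmall : 3 * δ + 3 * L / (δ * N) < 1 / 4 * μ.real P * μ.real Q) :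
    Aut.mk μ f ∉ obstructed μ (Aut.basicNhd μ A k) P Q := by
  intro hmem
  have hprob := isProbabilityMeasure_cycle (q := q) hr
  have hκ : ∀ d, 0 < (weightMeasure (cycleWeight q)).real {d} := fun d => by
    rw [measureReal_cycle_singleton]
    exact cycleWeight_pos d
  obtain ⟨h, hm, h0, h1, hint, hlow, hhigh, hn⟩ := exists_density_of_mem_obstructed hP hQ hmem
  set Pr := Measure.infinitePi fun _ : ℕ => μ with hPr
  set κ := weightMeasure (cycleWeight q) with hκdef
  have hint' : Integrable (fun y => h (θ y)) (κ.prod Pr) := hθ.integrable_comp_of_integrable hint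
  have hH01 : ∀ᵐ x ∂Pr, ∀ d, 0 ≤ h (θ (d, x)) ∧ h (θ (d, x)) ≤ 1 :=
    ae_fibre_of_ae_prod hκ (hθ.quasiMeasurePreserving.ae (h0.and h1))
  have hHint : ∀ d, Integrable (fun x => h (θ (d, x))) Pr := by
    intro d
    refine (integrable_const (1 : ℝ)).mono'
      ((hm.comp θ.measurable).comp measurable_prodMk_left).aestronglyMeasurable ?_
    filter_upwards [hH01] with x hx
    rw [Real.norm_eq_abs, abs_of_nonneg (hx d).1]
    exact (hx d).2
  have hvar : ∀ s (j j' : ZMod (q s)), ∀ᵐ x ∂Pr, h (θ (⟨s, j'⟩, x)) ≤ h (θ (⟨s, j⟩, x)) + 1 / 2 := by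
    intro s j j'
    -- This power moves only column `s`, of mass `1 / r`, hence lies in the neighbourhood and
    -- changes `h` by at most 1/2.
    obtain ⟨n, hn1, hn2⟩ := exists_rotation_pow hq s (j' - j)
    have hV : Aut.mk μ (f ^ n) ∈ Aut.basicNhd μ A k := by
      refine model_pow_mem_basicNhd hθ hf (lt_of_le_of_lt ?_ hk)
      rw [← measureReal_cycle_column (q := q) hr s]
      refine measureReal_mono (fun d hd => ?_) (measure_ne_top _ _)
      by_contra hds
      exact hd (hn2 d.1 hds d.2)
    have h2 := hn n (by rwa [zpow_natCast])
    rw [zpow_natCast] at h2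
    filter_upwards [ae_fibre_of_ae_prod hκ (hθ.quasiMeasurePreserving.ae h2)] with x hx
    have h3 := hx ⟨s, j⟩
    rw [model_pow hf] at h3
    dsimp only at h3
    rw [hn1] at h3
    simpa using h3
  let g : (Σ s : Fin r, ZMod (q s)) → X → X := fun d => ((f₀ ^ d.2.val : mpGroup μ) : Equiv.Perm X)
  have hg : ∀ d, MeasurePreserving (g d) μ μ := fun d => mpGroup.mp _
  let b : (Σ s : Fin r, ZMod (q s)) → ℕ := fun d => d.2.val / L
  have eQ := model_setIntegral hθ hκ (g := g) (b := b) hQ (hlab Q (by simp)) hint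
  have eP := model_setIntegral hθ hκ (g := g) (b := b) hP (hlab P (by simp)) hint
  simp only [hκdef, measureReal_cycle_singleton] at eQ eP
  rw [cycle_sum] at eQ eP
  set p := μ.real P with hp
  set p' := μ.real Q with hp'
  have hr' : (0 : ℝ) < r := Nat.cast_pos.2 hr
  -- This is the column estimate divided by `r * q s ^ 2`; the variance term becomes `3 L / (δ q
  -- s)`, bounded through `N ≤ q s`.
  have hcol : ∀ s : Fin r,
      p * (1 / (r * q s) * ∑ j : ZMod (q s), ∫ x in {x : ℕ → X | g ⟨s, j⟩ (x (b ⟨s, j⟩)) ∈ Q},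
          h (θ (⟨s, j⟩, x)) ∂Pr) -
        p' * (1 / (r * q s) * ∑ j : ZMod (q s), ∫ x in {x : ℕ → X | g ⟨s, j⟩ (x (b ⟨s, j⟩)) ∈ P},
          h (θ (⟨s, j⟩, x)) ∂Pr) ≤
      1 / r * (1 / 2 * p * p' + 3 * δ + 3 * L / (δ * N)) := by
    intro s
    have hqs : (0 : ℝ) < q s := Nat.cast_pos.2 (hN.trans_le (hqN s))
    have hNs : (N : ℝ) ≤ q s := Nat.cast_le.2 (hqN s)
    have hN' : (0 : ℝ) < N := Nat.cast_pos.2 hN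
    have h2 := column_integral_le (K := ZMod (q s)) (g := fun j => g ⟨s, j⟩) (fun j => hg _)
      (b := fun j => b ⟨s, j⟩) (L := L) (fun j => card_filter_val_div_eq_le hL j) hP hQ
      (H := fun j x => h (θ (⟨s, j⟩, x))) (fun j => hHint _)
      (fun j => by filter_upwards [hH01] with x hx using hx _) (fun j j' => hvar s j j') hδ
    rw [ZMod.card] at h2
    have h3 := mul_le_mul_of_nonneg_left h2 (by positivity : (0 : ℝ) ≤ 1 / (r * (q s : ℝ) ^ 2))
    refine le_trans (le_of_eq ?_) (h3.trans ?_)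
    · field_simp
      rfl
    · have h4 : 1 / (r * (q s : ℝ) ^ 2) * (1 / 2 * p * p' * (q s : ℝ) ^ 2 + 3 * δ * (q s : ℝ) ^ 2 +
          3 / (2 * δ) * (q s * L + q s * L)) =
          1 / r * (1 / 2 * p * p' + 3 * δ + 3 * L / (δ * q s)) := by
        field_simp
        ring
      rw [h4]
      gcongr
  have hsum := Finset.sum_le_sum fun s (_ : s ∈ Finset.univ) => hcol s
  rw [Finset.sum_sub_distrib, ← Finset.mul_sum, ← Finset.mul_sum, ← eQ, ← eP, Finset.sum_const,
    Finset.card_univ, Fintype.card_fin, nsmul_eq_mul, ← mul_assoc, mul_one_div_cancel hr'.ne',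
    one_mul] at hsum
  have hp0 : 0 ≤ p := measureReal_nonneg
  have hp0' : 0 ≤ p' := measureReal_nonneg
  -- The two means force a difference of at least `3/4 * p * p'`, while the sum over columns allows
  -- `1/2 * p * p'` plus an error below `1/4 * p * p'`.
  have h5 := mul_le_mul_of_nonneg_left hlow hp0'
  have h6 := mul_le_mul_of_nonneg_left hhigh hp0
  linarith

theorem exists_coprime_cycles (r N : ℕ) : ∃ q : Fin r → ℕ, (∀ s, N < q s) ∧
    Pairwise fun s t => (q s).Coprime (q t) := by
  refine ⟨fun s => Nat.nth Nat.Prime (N + s), fun s => ?_, fun s t hst => ?_⟩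
  · change N < Nat.nth Nat.Prime (N + s)
    have := Nat.add_two_le_nth_prime (N + s)
    omega
  · refine (Nat.coprime_primes (Nat.prime_nth_prime _) (Nat.prime_nth_prime _)).2 fun h => hst ?_
    have := Nat.nth_injective Nat.infinite_setOfPred_prime h
    exact Fin.ext (by omega)

theorem dense_compl_obstructed [StandardBorelSpace X] [NullSingletonClass μ] {A : ℕ → Set X}
    (hA : IsDenseSeparating μ A) (k : ℕ) {P Q : Set X} (hP : MeasurableSet P)
    (hQ : MeasurableSet Q) (hP0 : 0 < μ P) (hQ0 : 0 < μ Q) :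
    Dense (obstructed μ (Aut.basicNhd μ A k) P Q)ᶜ := by
  intro T₀
  rw [mem_closure_iff_nhds]
  intro W hW
  have hW' : (fun S => T₀ * S) ⁻¹' W ∈ 𝓝 (1 : Aut μ) :=
    (continuous_const_mul T₀).continuousAt.preimage_mem_nhds (by rwa [mul_one])
  obtain ⟨m, hm⟩ := Aut.exists_basicNhd_subset hA hW'
  set f₀ := Aut.rep T₀ with hf₀
  set ε : ℝ := 1 / ((m : ℝ) + 1) with hε
  have hε0 : 0 < ε := by positivity
  have hp0 : 0 < μ.real P := measureReal_pos_iff_measure_pos.2 hP0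
  have hp0' : 0 < μ.real Q := measureReal_pos_iff_measure_pos.2 hQ0
  -- With 24 the permitted error is exactly `6 δ`: one half for the term `3 δ`, the other for the
  -- variance.
  obtain ⟨δ, hδ⟩ : ∃ δ, δ = μ.real P * μ.real Q / 24 := ⟨_, rfl⟩
  have hδ0 : 0 < δ := by rw [hδ]; positivity
  obtain ⟨L', hL'⟩ := exists_nat_one_div_lt (half_pos hε0)
  obtain ⟨L, hL⟩ : ∃ L, L = L' + 1 := ⟨_, rfl⟩
  have hL0 : 0 < L := by omega
  have hLε : 1 / (L : ℝ) < ε / 2 := by rw [hL]; exact_mod_cast hL'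
  -- The bound `ε / 2`, with the one for `1 / L`, keeps the block starts below mass `ε`; the bound
  -- `δ ^ 2 / L` makes the variance term less than `3 δ`.
  obtain ⟨N', hN'⟩ := exists_nat_one_div_lt
    (lt_min (half_pos hε0) (show 0 < δ ^ 2 / L by positivity))
  obtain ⟨N, hN⟩ : ∃ N, N = N' + 1 := ⟨_, rfl⟩
  have hN0 : 0 < N := by omega
  have hN'' : 1 / (N : ℝ) < min (ε / 2) (δ ^ 2 / L) := by rw [hN]; exact_mod_cast hN'
  obtain ⟨r, hr⟩ : ∃ r, r = k + 2 := ⟨_, rfl⟩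
  have hr0 : 0 < r := by omega
  obtain ⟨q, hqN, hq⟩ := exists_coprime_cycles r N
  have : ∀ s, NeZero (q s) := fun s => ⟨(Nat.zero_lt_of_lt (hqN s)).ne'⟩
  have hprob := isProbabilityMeasure_cycle (q := q) hr0
  -- The first `m` sets and their images under `f₀` give closeness to `T₀`; `P` and `Q` are needed
  -- for the absence of an obstruction.
  let G : (Fin m ⊕ Fin m) ⊕ (Unit ⊕ Unit) → Set X :=
    Sum.elim (Sum.elim (fun i => A i) fun i => (f₀ : Equiv.Perm X) '' A i)
      (Sum.elim (fun _ => P) fun _ => Q)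
  have hG : ∀ i, MeasurableSet (G i) := by
    rintro ((i | i) | (i | i))
    · exact hA.measurableSet i
    · exact Aut.measurableSet_image T₀ (hA.measurableSet i)
    · exact hP
    · exact hQ
  obtain ⟨f, θ, hθ, hf, hlab⟩ := exists_modelled_transformation
    (weightMeasure (cycleWeight q)) (rotation q)
    (measurePreserving_weightMeasure fun d => rfl)
    (g := fun d => ((f₀ ^ d.2.val : mpGroup μ) : Equiv.Perm X)) (fun d => mpGroup.mp _)
    (fun d => d.2.val / L) hG
  refine ⟨Aut.mk μ f, ?_, ?_⟩
  · have h1 : T₀⁻¹ * Aut.mk μ f ∈ Aut.basicNhd μ A m := by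
      intro i hi
      rw [Measure.real, Aut.measure_translate T₀ _ (hA.measurableSet i)]
      change μ.real _ < ε
      rw [measureReal_symmDiff_congr_right _ (Aut.image_mk f (A i))]
      have h2 := model_measureReal_symmDiff_le (f₀ := f₀) (b := fun d => d.2.val / L)
        (c := fun d => d.2.val) (B := {d | L ∣ d.2.val}) hθ hf
        (fun d => by rw [measureReal_cycle_singleton]; exact cycleWeight_pos d)
        (fun d hd => val_add_one_of_not_dvd hd) (hlab (Sum.inl (Sum.inl ⟨i, hi⟩)))
        (hlab (Sum.inl (Sum.inr ⟨i, hi⟩)))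
      have h3 := measureReal_cycle_dvd_le hr0 (L := L) hN0 fun s => (hqN s).le
      have h4 := hN''.trans_le (min_le_left _ _)
      exact h2.trans_lt (by linarith)
    have h5 := hm h1
    rwa [mem_preimage, mul_inv_cancel_left] at h5
  · refine model_notMem_obstructed hr0 hq hL0 hN0 (fun s => (hqN s).le) ?_ (f₀ := f₀) hθ hf hP hQ
      ?_ hδ0 ?_
    · rw [hr]
      push_cast
      exact one_div_lt_one_div_of_lt (by positivity) (by linarith)
    · rintro E (rfl | rfl)
      · exact hlab (Sum.inr (Sum.inl ()))
      · exact hlab (Sum.inr (Sum.inr ()))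
    · have h4 := hN''.trans_le (min_le_right _ _)
      have h5 : 3 * (L : ℝ) / (δ * N) < 3 * δ := by
        have hN0' : (0 : ℝ) < N := Nat.cast_pos.2 hN0
        have hL0' : (0 : ℝ) < L := Nat.cast_pos.2 hL0
        rw [div_lt_div_iff₀ hN0' hL0'] at h4
        rw [div_lt_iff₀ (by positivity)]
        nlinarith
      have h6 : 1 / 4 * μ.real P * μ.real Q = 6 * δ := by rw [hδ]; ring
      rw [h6]
      linarith

theorem isGδ_and_dense_isWhirly [StandardBorelSpace X] [NullSingletonClass μ] :
    IsGδ {T : Aut μ | IsWhirly T} ∧ Dense {T : Aut μ | IsWhirly T} := by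
  obtain ⟨A, hA⟩ := exists_isDenseSeparating μ
  have := Aut.baireSpace (μ := μ)
  have hopen : ∀ (i : {i // 0 < μ (A i)}) (j : {j // 0 < μ (A j)}) (k : ℕ),
      IsOpen (obstructed μ (Aut.basicNhd μ A k) (A i) (A j))ᶜ := fun i j k =>
    (isClosed_obstructed (Aut.isOpen_basicNhd hA k) (hA.measurableSet i)
      (hA.measurableSet j)).isOpen_compl
  have hGδ : ∀ (i : {i // 0 < μ (A i)}) (j : {j // 0 < μ (A j)}) (k : ℕ),
      IsGδ (obstructed μ (Aut.basicNhd μ A k) (A i) (A j))ᶜ := fun i j k => (hopen i j k).isGδ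
  have hd : ∀ (i : {i // 0 < μ (A i)}) (j : {j // 0 < μ (A j)}) (k : ℕ),
      Dense (obstructed μ (Aut.basicNhd μ A k) (A i) (A j))ᶜ := fun i j k =>
    dense_compl_obstructed hA k (hA.measurableSet i) (hA.measurableSet j) i.2 j.2
  rw [setOf_isWhirly_eq hA]
  have h1 := fun i j => IsGδ.iInter fun k => hGδ i j k
  have h2 := fun i => IsGδ.iInter fun j => h1 i j
  refine ⟨IsGδ.iInter h2, ?_⟩
  refine dense_iInter_of_Gδ h2 fun i => dense_iInter_of_Gδ (h1 i) fun j => ?_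
  exact dense_iInter_of_Gδ (hGδ i j) fun k => hd i j k

end Whirly

theorem mainTheorem4 {X : Type*} [MeasurableSpace X] [StandardBorelSpace X]
    (μ : MeasureTheory.Measure X) [MeasureTheory.IsProbabilityMeasure μ]
    [MeasureTheory.NullSingletonClass μ] :
    (∀ T : Whirly.Aut μ, Whirly.IsWhirly T ↔ Whirly.IsWhirlyAction (Whirly.lamAction T)) ∧
      IsGδ {T : Whirly.Aut μ | Whirly.IsWhirlyAction (Whirly.lamAction T)} ∧
      Dense {T : Whirly.Aut μ | Whirly.IsWhirlyAction (Whirly.lamAction T)} := by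
  simp only [← Whirly.isWhirly_iff_isWhirlyAction, iff_self, implies_true, true_and]
  exact Whirly.isGδ_and_dense_isWhirly
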